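/- Let $G$ be a simple graph on $[n]=\{1,\dots,n\}$; write an edge as $ij$ with $i<j$. Call $G$ *perfectly labeled* if whenever $i<j<k$ and $ik,jk\in E(G)$, also $ij\in E(G)$. A *bond* of $G$ is a spanning subgraph $H$ of $G$ each of whose connected components is an induced subgraph of $G$; it is *noncrossing* if there are no $a<b<c<d$ with $a,c$ in one component of $H$ and $b,d$ in another. Let $NC_G$ be the set of noncrossing bonds of $G$ ordered by inclusion of edge sets; its minimum $\hat 0$ is the edgeless graph. Let $cc(H)$ be the number of connected components of $H$. Order edges colexicographically: $ab\lhd a'b'$ if $b<b'$, or $b=b'$ and $a<a'$. Edges *cross* if they are of the form $ac$ and $bd$ with $a<b<c<d$. For a graph $X$ on $[n]$, a *broken circuit* is the edge set of a cycle of $X$ with its $\lhd$-smallest edge removed, and an *NBC set* is a subset of $E(X)$ containing no broken circuit. Let $\mathrm{ncnbc}_k(X)$ be the number of $k$-element NBC sets of $X$ in which no two edges cross. An *increasing spanning forest* of $X$ is an acyclic spanning subgraph such that in each component the vertices along every path starting at the smallest vertex of that component form an increasing sequence. Let $\mathrm{ncisf}_k(X)$ be the number of increasing spanning forests of $X$ with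 $k$ edges, no two of which cross. **Theorem.** Let $G$ be a perfectly labeled graph on $[n]$ such that $NC_G$ has a maximum element $\hat 1$. Then: (a) $NC_G$ is graded (all maximal chains have the same length), and its rank function is $\rho(H)=n-cc(H)$. (b) The minimum labeling $\lambda(H\lessdot H')=\min_{\lhd}\big(E(H')\setminus E(H)\big)$ of the cover relations is an EL-labeling of $NC_G$: every interval has a unique maximal chain whose labels are strictly increasing from bottom to top, and the label sequence of this chain strictly precedes that of every other maximal chain of the interval in lexicographic order. Moreover $NC_G$ is shellable, i.e. its order complex is a shellable simplicial complex. (c) Let $\mu$ be the Möbius function of $NC_G$, defined by $\mu(\hat 0)=1$ and $\mu(H)=-\sum_{K<H}\mu(K)$ for $H\ne\hat 0$. For every $H\in NC_G$, $$\mu(H)=(-1)^{n-cc(H)}\,\mathrm{ncnbc}_{n-cc(H)}(H)=(-1)^{n-cc(H)}\,\mathrm{ncisf}_{n-cc(H)}(H).$$ Let $\rho(NC_G)$ be the rank of $NC_G$ (the common length of its maximal chains) and $\chi(NC_G,t)=\sum_{H\in NC_G}\mu(H)\,t^{\rho(NC_G)-\rho(H)}$ its characteristic polynomial. Then $$\chi(NC_G,t)=\sum_{k\ge0}(-1)^k\,\mathrm{ncnbc}_k(G)\,t^{\rho(NC_G)-k}=\sum_{k\ge0}(-1)^k\,\mathrm{ncisf}_k(G)\,t^{\rho(NC_G)-k},$$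 where $\mathrm{ncnbc}_k(G)=\mathrm{ncisf}_k(G)=0$ for $k>\rho(NC_G)$. -/

import Mathlib

namespace NCBond

/-! ### Finite posets: gradedness, Möbius function, characteristic polynomial -/

section Posets

variable (P : Type) [PartialOrder P]

/-- A poset is graded if all its maximal chains have the same finite length. -/
def IsGraded : Prop :=
  ∃ r : ℕ, ∀ F : Flag P, (F : Set P).Finite ∧ (F : Set P).ncard = r + 1

variable {P}

/-- `ρ` is `0` on minimal elements and increases by one along each cover. -/
def IsRankFunction (ρ : P → ℕ) : Prop :=
  (∀ x, IsMin x → ρ x = 0) ∧ ∀ x y, x ⋖ y → ρ y = ρ x + 1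

/-- The rank of `x`: the length of a longest chain ending at `x`. -/
noncomputable def rank (x : P) : ℕ := (Order.height x).toNat

variable (P) in
/-- The rank of a finite poset: the length of a longest chain. -/
noncomputable def posetRank [Fintype P] : ℕ := Finset.univ.sup (rank : P → ℕ)

open Classical in
/-- The one-variable Möbius function `μ(x) = μ(0̂, x)` of a finite poset with `0̂`. -/
noncomputable def mobius [Fintype P] [OrderBot P] (x : P) : ℤ :=
  letI : LocallyFiniteOrder P := Fintype.toLocallyFiniteOrder
  IncidenceAlgebra.mu ℤ (⊥ : P) x

variable (P) in
/-- The characteristic polynomial `∑ μ(x) t ^ (ρ(P) - ρ(x))` of a finite graded poset with `0̂`. -/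
noncomputable def charPoly [Fintype P] [OrderBot P] : Polynomial ℤ :=
  ∑ x : P, Polynomial.C (mobius x) * Polynomial.X ^ (posetRank P - rank x)

/-! ### Edge labelings -/

variable (P) in
/-- The edges of the Hasse diagram. -/
def HasseEdge : Type := {p : P × P // p.1 ⋖ p.2}

/-- Saturated chains `x = x₀ ⋖ x₁ ⋖ ⋯ ⋖ x_k = y`, that is, the maximal chains of `[x, y]`. -/
inductive SatChain : P → P → Type
  | nil (x : P) : SatChain x x
  | cons {x y z : P} (h : x ⋖ y) (c : SatChain y z) : SatChain x z

/-- The sequence of labels along a saturated chain, from bottom to top. -/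
def SatChain.labels {Λ : Type} (lab : HasseEdge P → Λ) : {x y : P} → SatChain x y → List Λ
  | _, _, .nil _ => []
  | _, _, .cons (x := x) (y := y) h c => lab ⟨(x, y), h⟩ :: c.labels lab

/-- A saturated chain is increasing if its labels strictly increase from bottom to top. -/
def SatChain.IsIncreasing {Λ : Type} [PartialOrder Λ] (lab : HasseEdge P → Λ) {x y : P}
    (c : SatChain x y) : Prop :=
  (c.labels lab).IsChain (· < ·)

/-- Every interval has a unique increasing maximal chain, and this chain lexicographically
precedes all other maximal chains of the interval. -/
def IsELLabeling {Λ : Type} [PartialOrder Λ] (lab : HasseEdge P → Λ) : Prop :=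
  ∀ x y : P, x ≤ y → ∃ c : SatChain x y, c.IsIncreasing lab ∧
    (∀ c' : SatChain x y, c'.IsIncreasing lab → c' = c) ∧
    ∀ c' : SatChain x y, c' ≠ c → List.Lex (· < ·) (c.labels lab) (c'.labels lab)

/-! ### Shellability -/

/-- The facets of a simplicial complex `K`, given by its set of faces (with the empty face). -/
def IsFacet {V : Type} (K : Set (Finset V)) (F : Finset V) : Prop := Maximal (· ∈ K) F

/-- A finite simplicial complex is shellable if its facets can be listed as `F₀, …, F_t` such that,
for `j > 0`, the subcomplex `⟨F_j⟩ ∩ (⟨F₀⟩ ∪ ⋯ ∪ ⟨F_{j-1}⟩)` is pure of dimension `dim F_j - 1`. -/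
def IsShellableComplex {V : Type} (K : Set (Finset V)) : Prop :=
  ∃ l : List (Finset V), l.Nodup ∧ (∀ F, F ∈ l ↔ IsFacet K F) ∧
    ∀ (j : Fin l.length), 0 < (j : ℕ) →
      ∀ s, IsFacet {s | s ⊆ l.get j ∧ ∃ i : Fin l.length, i < j ∧ s ⊆ l.get i} s →
        s.card + 1 = (l.get j).card

variable (P) in
/-- The order complex: the faces are the finite chains. -/
def orderComplex : Set (Finset P) := {s | IsChain (· ≤ ·) (s : Set P)}

variable (P) in
/-- A poset is shellable if its order complex is. -/
def IsShellable : Prop := IsShellableComplex (orderComplex P)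

end Posets

/-! ### Noncrossing bonds -/

section Graphs

variable {n : ℕ}

/-- A spanning subgraph `H` of `G` all of whose connected components are induced subgraphs. -/
def IsBond (G H : SimpleGraph (Fin n)) : Prop :=
  H ≤ G ∧ ∀ u v, H.Reachable u v → G.Adj u v → H.Adj u v

/-- A set partition (given as an equivalence relation) is crossing if there are `a < b < c < d`
with `a, c` in one block and `b, d` in a different block. -/
def IsCrossingPartition (π : Setoid (Fin n)) : Prop :=
  ∃ a b c d, a < b ∧ b < c ∧ c < d ∧ π a c ∧ π b d ∧ ¬ π a b

/-- Noncrossing bonds: those whose partition into connected components is noncrossing. -/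
def IsNoncrossingBond (G H : SimpleGraph (Fin n)) : Prop :=
  IsBond G H ∧ ¬ IsCrossingPartition H.reachableSetoid

/-- The noncrossing bond poset, ordered by inclusion. -/
abbrev NC (G : SimpleGraph (Fin n)) : Type :=
  {H : SimpleGraph (Fin n) // IsNoncrossingBond G H}

noncomputable instance (G : SimpleGraph (Fin n)) : Fintype (NC G) := Fintype.ofFinite _

theorem isNoncrossingBond_bot (G : SimpleGraph (Fin n)) : IsNoncrossingBond G ⊥ := by
  refine ⟨⟨bot_le, fun u v h hG => ?_⟩, ?_⟩
  · rw [SimpleGraph.reachable_bot] at h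
    exact absurd h hG.ne
  · rintro ⟨a, b, c, d, hab, hbc, -, hac, -⟩
    have h : (⊥ : SimpleGraph (Fin n)).Reachable a c := hac
    rw [SimpleGraph.reachable_bot] at h
    exact absurd h (hab.trans hbc).ne

instance (G : SimpleGraph (Fin n)) : OrderBot (NC G) where
  bot := ⟨⊥, isNoncrossingBond_bot G⟩
  bot_le H := (bot_le : (⊥ : SimpleGraph (Fin n)) ≤ H.1)

/-- The number of connected components. -/
noncomputable def cc (H : SimpleGraph (Fin n)) : ℕ := Nat.card H.ConnectedComponent

/-- If `i < j < k` and `ik`, `jk` are edges then `ij` is an edge. -/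
def IsPerfectlyLabeled (G : SimpleGraph (Fin n)) : Prop :=
  ∀ i j k, i < j → j < k → G.Adj i k → G.Adj j k → G.Adj i j

/-! ### The colexicographic order and the minimum labeling -/

/-- For `a < b` the edge `ab` is sent to `(b, a)`, so that the colexicographic order on edges is
the lexicographic order on these pairs. -/
def colexKey (e : Sym2 (Fin n)) : Lex (Fin n × Fin n) := toLex (e.sup, e.inf)

theorem colexKey_injective : Function.Injective (colexKey (n := n)) := by
  intro e f h
  induction e using Sym2.ind with | _ a b =>
  induction f using Sym2.ind with | _ c d =>
  have h' : (a ⊔ b, a ⊓ b) = (c ⊔ d, c ⊓ d) := toLex.injective h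
  rw [Prod.mk.injEq] at h'
  obtain ⟨h1, h2⟩ := h'
  rw [Sym2.eq_iff]
  rcases le_total a b with hab | hab <;> rcases le_total c d with hcd | hcd <;>
    simp_all

/-- The edges of `G`, as a type of labels with the colexicographic order. -/
def ColexEdge (G : SimpleGraph (Fin n)) : Type := {e : Sym2 (Fin n) // e ∈ G.edgeSet}

noncomputable instance (G : SimpleGraph (Fin n)) : LinearOrder (ColexEdge G) :=
  LinearOrder.lift' (fun e : ColexEdge G => colexKey e.1)
    (fun _ _ h => Subtype.ext (colexKey_injective h))

noncomputable instance (G : SimpleGraph (Fin n)) : Fintype (ColexEdge G) :=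
  @Fintype.ofFinite _ (inferInstanceAs (Finite {e : Sym2 (Fin n) // e ∈ G.edgeSet}))

open Classical in
/-- The edges of `H'` that are not edges of `H`. -/
noncomputable def newEdges {G : SimpleGraph (Fin n)} (H H' : NC G) : Finset (ColexEdge G) :=
  Finset.univ.filter fun e => e.1 ∈ H'.1.edgeSet ∧ e.1 ∉ H.1.edgeSet

open Classical in
theorem newEdges_nonempty {G : SimpleGraph (Fin n)} {H H' : NC G} (h : H < H') :
    (newEdges H H').Nonempty := by
  have h1 : ¬ H'.1.edgeSet ⊆ H.1.edgeSet := by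
    rw [SimpleGraph.edgeSet_subset_edgeSet]
    exact not_le_of_gt h
  obtain ⟨e, he, he'⟩ := Set.not_subset.mp h1
  let e' : ColexEdge G := ⟨e, SimpleGraph.edgeSet_mono H'.2.1.1 he⟩
  have h2 : e'.1 ∈ H'.1.edgeSet ∧ e'.1 ∉ H.1.edgeSet := ⟨he, he'⟩
  refine ⟨e', ?_⟩
  unfold newEdges
  rw [Finset.mem_filter]
  exact ⟨Finset.mem_univ _, h2⟩

/-- The minimum labeling `λ(H ⋖ H') = min (E(H') \ E(H))` for the colexicographic order. -/
noncomputable def minLabeling (G : SimpleGraph (Fin n)) (p : HasseEdge (NC G)) : ColexEdge G :=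
  (newEdges p.1.1 p.1.2).min' (newEdges_nonempty p.2.lt)

/-! ### Noncrossing NBC sets and noncrossing increasing spanning forests -/

/-- Two edges cross if they are `ac` and `bd` with `a < b < c < d`. -/
def EdgesCross (e f : Sym2 (Fin n)) : Prop :=
  ∃ a b c d, a < b ∧ b < c ∧ c < d ∧
    ((e = s(a, c) ∧ f = s(b, d)) ∨ (e = s(b, d) ∧ f = s(a, c)))

/-- A cycle of `X` with its colexicographically smallest edge removed. -/
def IsBrokenCircuit (X : SimpleGraph (Fin n)) (B : Finset (Sym2 (Fin n))) : Prop :=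
  ∃ (v : Fin n) (p : X.Walk v v), p.IsCycle ∧
    ∃ e ∈ p.edges, (∀ f ∈ p.edges, colexKey e ≤ colexKey f) ∧ B = p.edges.toFinset.erase e

/-- NBC sets of `X` with respect to the colexicographic order. -/
def IsNBC (X : SimpleGraph (Fin n)) (S : Finset (Sym2 (Fin n))) : Prop :=
  (S : Set (Sym2 (Fin n))) ⊆ X.edgeSet ∧ ∀ B, IsBrokenCircuit X B → ¬ B ⊆ S

/-- The number of noncrossing NBC sets of `X` with `k` elements. -/
noncomputable def ncnbc (k : ℕ) (X : SimpleGraph (Fin n)) : ℕ :=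
  Set.ncard {S : Finset (Sym2 (Fin n)) |
    IsNBC X S ∧ (∀ e ∈ S, ∀ f ∈ S, ¬ EdgesCross e f) ∧ S.card = k}

/-- A spanning forest of `X` in each of whose components every path starting at the smallest
vertex of the component is increasing. -/
def IsIncreasingSpanningForest (X F : SimpleGraph (Fin n)) : Prop :=
  F ≤ X ∧ F.IsAcyclic ∧
    ∀ (r v : Fin n) (p : F.Walk r v), (∀ w, F.Reachable r w → r ≤ w) → p.IsPath →
      p.support.IsChain (· < ·)

/-- The number of noncrossing increasing spanning forests of `X` with `k` edges. -/
noncomputable def ncisf (k : ℕ) (X : SimpleGraph (Fin n)) : ℕ :=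
  Set.ncard {F : SimpleGraph (Fin n) | IsIncreasingSpanningForest X F ∧
    (∀ e ∈ F.edgeSet, ∀ f ∈ F.edgeSet, ¬ EdgesCross e f) ∧ F.edgeSet.ncard = k}

end Graphs

end NCBond

open NCBond

/-! In a perfectly labeled graph any two lower neighbors of a vertex are adjacent. Hence moving to a
lower neighbor is a confluent process, and connectivity among vertices below `b` depends only on the
edges whose upper end is below `b`.

The order-theoretic half rests on `IsNoncrossingBond.merge`. If `H < H'` and `ab` is the colex-least
edge of `H'` outside `H`, then merging the components of `a` and `b` keeps `H` noncrossing and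
lowers the number of components by exactly one. The result is the least noncrossing bond above `H`
containing `ab`, so it covers `H` and lies below `H'`. This makes `n - cc` the rank function. It is
also the only input from graphs needed for (b): an abstract argument on posets with such a labeling
(`IsMinLabeling`) yields the EL property, and shellability by exchanging one element of a chain at a
descent.

The enumerative half replaces NBC sets and increasing forests by one notion: edge sets in which no
vertex is the upper end of two edges. A noncrossing set `S` of this kind spans a noncrossing bond of
rank `|S|`, which lies below `H` exactly when `S` consists of edges of `H`. The sum over `K ≤ H` of
the claimed Möbius values is therefore the sum of `(-1)^|S|` over all such `S` in `H`. For `H ≠ ⊥`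
it vanishes, because an edge with least upper end can be toggled freely. Grouping all forests of `G`
by the bond they span, or by cardinality, gives the characteristic polynomial. -/

namespace NCBond

/-! ### Saturated chains -/

section SatChains

variable {P : Type} [PartialOrder P]

theorem SatChain.le {x y : P} (c : SatChain x y) : x ≤ y := by
  induction c with
  | nil x => exact le_rfl
  | cons h c ih => exact h.le.trans ih

/-- The elements of a saturated chain, from bottom to top. -/
def SatChain.support : {x y : P} → SatChain x y → List P
  | _, _, .nil x => [x]
  | _, _, .cons (x := x) _ c => x :: c.support

theorem SatChain.le_of_mem_support {x y z : P} (c : SatChain x y) (hz : z ∈ c.support) :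
    x ≤ z := by
  induction c with
  | nil x => simp only [support, List.mem_singleton] at hz; exact hz.ge
  | cons h c ih =>
    simp only [support, List.mem_cons] at hz
    rcases hz with rfl | hz
    · exact le_rfl
    · exact h.le.trans (ih hz)

theorem SatChain.left_mem_support {x y : P} (c : SatChain x y) : x ∈ c.support := by
  cases c <;> simp [support]

theorem SatChain.right_mem_support {x y : P} (c : SatChain x y) : y ∈ c.support := by
  induction c with
  | nil x => simp [support]
  | cons h c ih => simp [support, ih]

theorem SatChain.left_notMem_support {x u y : P} (h : x ⋖ u) (c : SatChain u y) :
    x ∉ c.support :=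
  fun hx => (h.lt.trans_le (c.le_of_mem_support hx)).false

theorem SatChain.pairwise_support {x y : P} (c : SatChain x y) :
    c.support.Pairwise (· < ·) := by
  induction c with
  | nil x => simp [support]
  | cons h c ih =>
    simp only [support, List.pairwise_cons]
    exact ⟨fun z hz => h.lt.trans_le (c.le_of_mem_support hz), ih⟩

theorem SatChain.nodup_support {x y : P} (c : SatChain x y) : c.support.Nodup :=
  c.pairwise_support.imp fun h => h.ne

theorem SatChain.isChain_support {x y : P} (c : SatChain x y) :
    IsChain (· ≤ ·) {z | z ∈ c.support} := by
  induction c with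
  | nil x =>
    intro a ha b hb hab
    simp only [support, List.mem_singleton, Set.mem_ofPred_eq] at ha hb
    exact absurd (ha.trans hb.symm) hab
  | cons h c ih =>
    intro a ha b hb hab
    simp only [support, List.mem_cons, Set.mem_ofPred_eq] at ha hb
    rcases ha with rfl | ha <;> rcases hb with rfl | hb
    · exact absurd rfl hab
    · exact .inl (h.le.trans (c.le_of_mem_support hb))
    · exact .inr (h.le.trans (c.le_of_mem_support ha))
    · exact ih ha hb hab

/-- A saturated chain is maximal in its interval. -/
theorem SatChain.mem_support_of_comparable {x y z : P} (c : SatChain x y) (hx : x ≤ z)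
    (hy : z ≤ y) (hz : ∀ w ∈ c.support, z ≤ w ∨ w ≤ z) : z ∈ c.support := by
  induction c with
  | nil x => simp [support, le_antisymm hy hx]
  | @cons x u y h c ih =>
    simp only [support, List.mem_cons] at hz ⊢
    rcases hz u (.inr c.left_mem_support) with hu | hu
    · rcases h.eq_or_eq hx hu with h1 | h1
      · exact .inl h1
      · exact .inr (h1 ▸ c.left_mem_support)
    · exact .inr (ih hu hy fun w hw => hz w (.inr hw))

theorem SatChain.eq_of_support_eq {x y : P} (c c' : SatChain x y)
    (h : ∀ z, z ∈ c.support ↔ z ∈ c'.support) : c = c' := by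
  induction c with
  | nil x =>
    cases c' with
    | nil => rfl
    | cons h' t' => exact absurd (h'.lt.trans_le t'.le) (lt_irrefl _)
  | @cons x u y hu t ih =>
    cases c' with
    | nil => exact absurd (hu.lt.trans_le t.le) (lt_irrefl _)
    | @cons _ u' _ hu' t' =>
      simp only [support, List.mem_cons] at h
      have h1 : u ∈ t'.support :=
        ((h u).1 (.inr t.left_mem_support)).resolve_left hu.lt.ne'
      have h2 : u' ∈ t.support :=
        ((h u').2 (.inr t'.left_mem_support)).resolve_left hu'.lt.ne'
      obtain rfl : u = u' := le_antisymm (t.le_of_mem_support h2) (t'.le_of_mem_support h1)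
      rw [ih t' fun z => ?_]
      constructor
      · intro hz
        exact ((h z).1 (.inr hz)).resolve_left fun e => left_notMem_support hu t (e ▸ hz)
      · intro hz
        exact ((h z).2 (.inr hz)).resolve_left fun e => left_notMem_support hu' t' (e ▸ hz)

/-- A maximal chain of a finite poset with a top element is saturated. -/
theorem exists_satChain_of_maximal [Finite P] {t : P} {F : Set P} (hF : IsChain (· ≤ ·) F)
    (hmax : ∀ z, (∀ w ∈ F, z ≤ w ∨ w ≤ z) → z ∈ F) (ht : IsTop t) (x : P) (hx : x ∈ F) :
    ∃ c : SatChain x t, ∀ z, z ∈ c.support ↔ z ∈ F ∧ x ≤ z := by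
  induction x using WellFoundedGT.induction with
  | ind x ih =>
  rcases (ht x).eq_or_lt with rfl | hlt
  · refine ⟨.nil x, fun z => ?_⟩
    simp only [SatChain.support, List.mem_singleton]
    exact ⟨fun h => by rw [h]; exact ⟨hx, le_rfl⟩, fun h => le_antisymm (ht z) h.2⟩
  · have htF : t ∈ F := hmax t fun w _ => .inr (ht w)
    obtain ⟨u, ⟨huF, hxu⟩, hu⟩ :=
      (Set.toFinite {z | z ∈ F ∧ x < z}).exists_minimal ⟨t, htF, hlt⟩
    have key : ∀ z ∈ F, x < z → u ≤ z := fun z hz hxz =>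
      (hF.total huF hz).elim id fun h => hu ⟨hz, hxz⟩ h
    have hcov : x ⋖ u := by
      refine ⟨hxu, fun z hxz hzu => ?_⟩
      -- An element strictly between `x` and `u` would be comparable with all of `F`, so maximality
      -- would put it into `F`, against the choice of `u`.
      have hzF : z ∈ F := hmax z fun w hw => by
        rcases hF.total hw hx with h | h
        · exact .inr (h.trans hxz.le)
        · rcases h.eq_or_lt with rfl | h
          · exact .inr hxz.le
          · exact .inl (hzu.le.trans (key w hw h))
      exact (hzu.trans_le (key z hzF hxz)).false
    obtain ⟨c, hc⟩ := ih u hxu huF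
    refine ⟨.cons hcov c, fun z => ?_⟩
    simp only [SatChain.support, List.mem_cons, hc]
    constructor
    · rintro (h | ⟨h, h'⟩)
      · rw [h]; exact ⟨hx, le_rfl⟩
      · exact ⟨h, hxu.le.trans h'⟩
    · rintro ⟨h, h'⟩
      rcases h'.eq_or_lt with rfl | h'
      · exact .inl rfl
      · exact .inr ⟨h, key z h h'⟩

theorem SatChain.length_support {ρ : P → ℕ} (hρ : ∀ x y, x ⋖ y → ρ y = ρ x + 1) {x y : P}
    (c : SatChain x y) : c.support.length + ρ x = ρ y + 1 := by
  induction c with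
  | nil x => simp [support, add_comm]
  | cons h c ih =>
    have := hρ _ _ h
    simp only [support, List.length_cons]
    omega

theorem isGraded_of_covBy [Finite P] {ρ : P → ℕ} (hρ : ∀ x y, x ⋖ y → ρ y = ρ x + 1)
    {b t : P} (hb : IsBot b) (ht : IsTop t) : IsGraded P := by
  classical
  refine ⟨ρ t - ρ b, fun F => ⟨Set.toFinite _, ?_⟩⟩
  have hmax : ∀ z, (∀ w ∈ (F : Set P), z ≤ w ∨ w ≤ z) → z ∈ (F : Set P) := fun z hz => by
    have h := F.maxChain.2 (F.Chain'.insert (a := z) fun w hw _ => hz w hw) (Set.subset_insert _ _)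
    rw [h]
    exact Set.mem_insert _ _
  have hbF := hmax b fun w _ => .inl (hb w)
  obtain ⟨c, hc⟩ := exists_satChain_of_maximal F.Chain' hmax ht b hbF
  have hF : (F : Set P) = (c.support.toFinset : Set P) := by
    ext z
    simp only [List.coe_toFinset, Set.mem_ofPred_eq, hc]
    exact ⟨fun h => ⟨h, hb z⟩, fun h => h.1⟩
  have hl := c.length_support hρ
  have : ρ b ≤ ρ t := by
    have := List.length_pos_of_mem c.left_mem_support
    omega
  rw [hF, Set.ncard_coe_finset, List.toFinset_card_of_nodup c.nodup_support]
  omega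

/-- Strict monotonicity bounds the height above by `ρ`; descending along covers to the bottom bounds
it below. -/
theorem height_eq_of_covBy [Finite P] [OrderBot P] {ρ : P → ℕ} (hmono : StrictMono ρ)
    (hρ : ∀ x y, x ⋖ y → ρ y = ρ x + 1) (hbot : ρ ⊥ = 0) (x : P) : rank x = ρ x := by
  have h1 : Order.height x ≤ ρ x := by
    simpa [Order.height_nat] using Order.height_le_height_apply_of_strictMono ρ hmono x
  have h2 : ∀ x : P, (ρ x : ℕ∞) ≤ Order.height x := by
    intro x
    induction x using WellFoundedLT.induction with
    | ind x ih =>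
    rcases (bot_le : ⊥ ≤ x).eq_or_lt with rfl | h
    · simp [hbot]
    · obtain ⟨y, -, hy⟩ := exists_le_covBy_of_lt h
      rw [hρ y x hy]
      push_cast
      exact (add_le_add_left (ih y hy.lt) 1).trans (Order.height_add_one_le hy.lt)
  rw [rank, le_antisymm h1 (h2 x)]
  rfl

end SatChains

/-! ### Minimum labelings -/

section MinLabelings

variable {P : Type} [PartialOrder P] {Λ : Type} [LinearOrder Λ]

/-- A labeling `lab` by the least new atom, such that for `x < y` there is a least element above
`x` containing the least atom of `y` not in `x`, and it covers `x`. -/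
structure IsMinLabeling (E : P → Set Λ) (lab : HasseEdge P → Λ) : Prop where
  mono : Monotone E
  isLeast : ∀ {x y : P} (h : x ⋖ y), IsLeast (E y \ E x) (lab ⟨(x, y), h⟩)
  exists_covBy : ∀ x y : P, x < y → ∃ e z, IsLeast (E y \ E x) e ∧ x ⋖ z ∧ z ≤ y ∧ e ∈ E z ∧
    ∀ w, x ≤ w → e ∈ E w → z ≤ w

variable {E : P → Set Λ} {lab : HasseEdge P → Λ}

theorem IsMinLabeling.labels_mem (H : IsMinLabeling E lab) {x y : P} (c : SatChain x y) :
    ∀ l ∈ c.labels lab, l ∈ E y \ E x := by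
  induction c with
  | nil x => simp [SatChain.labels]
  | cons h c ih =>
    simp only [SatChain.labels, List.mem_cons]
    rintro l (rfl | hl)
    · exact ⟨H.mono c.le (H.isLeast h).1.1, (H.isLeast h).1.2⟩
    · exact ⟨(ih l hl).1, fun hx => (ih l hl).2 (H.mono h.le hx)⟩

/-- At the step of the chain where `e` is acquired, the label is the least new atom, hence at most
`e`. -/
theorem IsMinLabeling.exists_label_le (H : IsMinLabeling E lab) {x y : P} (c : SatChain x y)
    {e : Λ} (he : e ∈ E y \ E x) : ∃ l ∈ c.labels lab, l ≤ e := by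
  induction c with
  | nil x => exact absurd he.1 he.2
  | @cons x u y h c ih =>
    simp only [SatChain.labels, List.mem_cons, exists_eq_or_imp]
    by_cases heu : e ∈ E u
    · exact .inl ((H.isLeast h).2 ⟨heu, he.2⟩)
    · exact .inr (ih ⟨he.1, heu⟩)

/-- Let `e` be the least atom of `y` not in `x`, and `z` the cover of `x` generated by `e`. Every
label on a chain from `x` to `y` is at least `e`, and a first step labeled `e` must go to `z`. An
increasing chain cannot postpone `e`, since a later label would then be at most `e`; so it also
starts at `z`, and induction on `[z, y]` finishes. -/
theorem IsMinLabeling.isELLabeling [Finite P] (H : IsMinLabeling E lab) : IsELLabeling lab := by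
  intro x y hxy
  induction x using WellFoundedGT.induction with
  | ind x ih =>
  rcases hxy.eq_or_lt with rfl | hlt
  · have huniq : ∀ c : SatChain x x, c = .nil x := fun c =>
      match c with
      | .nil _ => rfl
      | .cons h t => absurd (h.lt.trans_le t.le) (lt_irrefl _)
    exact ⟨.nil x, List.isChain_nil, fun c _ => huniq c, fun c hc => absurd (huniq c) hc⟩
  obtain ⟨e, z, he, hz, hzy, hez, hmin⟩ := H.exists_covBy x y hlt
  obtain ⟨c, hc, hcu, hcl⟩ := ih z hz.lt hzy
  have hlab : lab ⟨(x, z), hz⟩ = e :=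
    (H.isLeast hz).unique ⟨⟨hez, he.1.2⟩, fun f hf => he.2 ⟨H.mono hzy hf.1, hf.2⟩⟩
  have hstep : ∀ u, x ⋖ u → e ∈ E u → z = u := fun u hu heu =>
    (hu.eq_or_eq hz.le (hmin u hu.le heu)).resolve_left hz.lt.ne'
  refine ⟨.cons hz c, ?_, ?_, ?_⟩
  · refine List.isChain_cons.2 ⟨fun l hl => ?_, hc⟩
    have hl' := H.labels_mem c l (List.mem_of_mem_head? hl)
    have hle := he.2 ⟨hl'.1, fun hx => hl'.2 (H.mono hz.le hx)⟩
    rw [hlab]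
    exact hle.lt_of_ne fun h => hl'.2 (h ▸ hez)
  · rintro c' hc'
    cases c' with
    | nil => exact absurd hlt (lt_irrefl _)
    | @cons _ u _ hu t =>
      have hpw := (List.isChain_iff_pairwise.1 hc')
      simp only [SatChain.labels, List.pairwise_cons] at hpw
      have heu : e ∈ E u := by
        by_contra heu
        obtain ⟨l, hl, hle⟩ := H.exists_label_le t ⟨he.1.1, heu⟩
        have h1 := hpw.1 l hl
        have h2 := he.2 (H.labels_mem (.cons hu t) (lab ⟨(x, u), hu⟩) (by simp [SatChain.labels]))
        exact absurd (h1.trans_le hle) h2.not_gt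
      obtain rfl := hstep u hu heu
      rw [hcu t (List.isChain_iff_pairwise.2 hpw.2)]
  · intro c' hc'
    cases c' with
    | nil => exact absurd hlt (lt_irrefl _)
    | @cons _ u _ hu t =>
      have h2 := he.2 (H.labels_mem (.cons hu t) (lab ⟨(x, u), hu⟩) (by simp [SatChain.labels]))
      simp only [SatChain.labels]
      rcases h2.eq_or_lt with h2 | h2
      · obtain rfl := hstep u hu (h2 ▸ (H.isLeast hu).1.1)
        exact .cons (hcl t fun h => hc' (h ▸ rfl))
      · exact .rel (hlab ▸ h2)

/-- If the first label of a saturated chain exceeds an atom acquired by the element `z` of the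
chain, then replacing some element strictly below `z` makes the labels lexicographically
smaller. -/
theorem IsMinLabeling.exists_swap (H : IsMinLabeling E lab) {ρ : P → ℕ} (hmono : StrictMono ρ)
    (hρ : ∀ x y, x ⋖ y → ρ y = ρ x + 1) {e : Λ} {z : P} {x u y : P} (h : x ⋖ u)
    (t : SatChain u y) (hz : z ∈ t.support) (he : e ∈ E z \ E x)
    (hlt : e < lab ⟨(x, u), h⟩) :
    ∃ (w : P) (c' : SatChain x y), w ∈ t.support ∧ w < z ∧
      c'.labels lab < (SatChain.cons h t).labels lab ∧
      ∀ v ∈ (SatChain.cons h t).support, v ≠ w → v ∈ c'.support := by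
  induction t generalizing x with
  | nil u =>
    simp only [SatChain.support, List.mem_singleton] at hz
    subst hz
    exact absurd ((H.isLeast h).2 he) hlt.not_ge
  | @cons u v y hv t ih =>
    have heu : e ∉ E u := fun heu => absurd ((H.isLeast h).2 ⟨heu, he.2⟩) hlt.not_ge
    have hzt : z ∈ t.support := by
      simp only [SatChain.support, List.mem_cons] at hz
      exact hz.resolve_left fun hzu => heu (hzu ▸ he.1)
    -- At a descent, `u` is exchanged for the cover `k` of `x` generated by the least atom of `v`
    -- not in `x`: its label is at most that of `u ⋖ v`, hence below that of `x ⋖ u`. Without a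
    -- descent the labels stay above `e` and the search moves up; it ends before `z`, where `e` has
    -- already been acquired.
    by_cases hd : lab ⟨(u, v), hv⟩ < lab ⟨(x, u), h⟩
    · obtain ⟨f, k, hf, hk, hkv, hfk, -⟩ := H.exists_covBy x v (h.lt.trans hv.lt)
      have r1 := hρ _ _ h
      have r2 := hρ _ _ hv
      have r3 := hρ _ _ hk
      have hkv' : k < v := hkv.lt_of_ne fun e => by subst e; omega
      -- `v` has rank two more than `x` and `k` one more, so nothing fits between `k` and `v`.
      have hcov : k ⋖ v := ⟨hkv', fun a h1 h2 => by
        have := hmono h1; have := hmono h2; omega⟩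
      refine ⟨u, .cons hk (.cons hcov t), by simp [SatChain.support],
        hv.lt.trans_le (t.le_of_mem_support hzt), ?_, ?_⟩
      · simp only [SatChain.labels]
        refine List.Lex.rel (((H.isLeast hk).2 ⟨hfk, hf.1.2⟩).trans_lt (lt_of_le_of_lt ?_ hd))
        exact hf.2 ⟨(H.isLeast hv).1.1, fun hx => (H.isLeast hv).1.2 (H.mono h.le hx)⟩
      · intro a ha hau
        simp only [SatChain.support, List.mem_cons] at ha ⊢
        tauto
    · obtain ⟨w, c', hw, hwz, hl, hs⟩ := ih hv hzt ⟨he.1, heu⟩ (hlt.trans_le (not_lt.1 hd))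
      refine ⟨w, .cons h c', by simp [SatChain.support, hw], hwz, List.Lex.cons hl, ?_⟩
      intro a ha haw
      rw [SatChain.support, List.mem_cons] at ha ⊢
      exact ha.imp id fun ha => hs a ha haw

/-- This is the exchange condition behind shelling: whatever `c'` shares with a chain `c` that is
not later avoids some `w`, and the rest of `c'` lies in a strictly earlier chain. The hypothesis is
non-strict so that ties between label sequences may be broken arbitrarily. -/
theorem IsMinLabeling.exists_earlier (H : IsMinLabeling E lab) {ρ : P → ℕ}
    (hmono : StrictMono ρ) (hρ : ∀ x y, x ⋖ y → ρ y = ρ x + 1) {x y : P} (c c' : SatChain x y)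
    (hne : c ≠ c') (hle : ¬ c'.labels lab < c.labels lab) :
    ∃ (w : P) (c'' : SatChain x y), w ∈ c'.support ∧ w ∉ c.support ∧
      c''.labels lab < c'.labels lab ∧ ∀ v ∈ c'.support, v ≠ w → v ∈ c''.support := by
  induction c with
  | nil x =>
    cases c' with
    | nil => exact absurd rfl hne
    | cons h' t' => exact absurd (h'.lt.trans_le t'.le) (lt_irrefl _)
  | @cons x u y h t ih =>
    cases c' with
    | nil => exact absurd (h.lt.trans_le t.le) (lt_irrefl _)
    | @cons _ u' _ h' t' =>
    simp only [SatChain.labels, List.cons_lt_cons_iff, not_or, not_and, not_lt] at hle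
    by_cases huu : u = u'
    · subst huu
      obtain ⟨w, c'', hw, hw', hl, hs⟩ := ih t' (fun e => hne (e ▸ rfl))
        (not_lt.2 (hle.2 rfl))
      refine ⟨w, .cons h c'', by simp [SatChain.support, hw], ?_, List.Lex.cons hl, ?_⟩
      · simp only [SatChain.support, List.mem_cons, not_or]
        exact ⟨fun e => SatChain.left_notMem_support h t' (e ▸ hw), hw'⟩
      · intro a ha haw
        rw [SatChain.support, List.mem_cons] at ha ⊢
        exact ha.imp id fun ha => hs a ha haw
    · have hfin : {z | z ∈ t'.support ∧ z ∈ t.support}.Finite :=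
        t.support.finite_toSet.subset fun z hz => hz.2
      -- After the two chains diverge at `x`, `z` is where they first meet again; an element of `c'`
      -- strictly between `x` and `z` is not on `c`.
      obtain ⟨z, ⟨hz', hz⟩, hzmin⟩ :=
        hfin.exists_minimal ⟨y, t'.right_mem_support, t.right_mem_support⟩
      have hxz : x < z := h.lt.trans_le (t.le_of_mem_support hz)
      obtain ⟨e, k, he, hk, hkz, hek, hkmin⟩ := H.exists_covBy x z hxz
      have hstep : ∀ v, x ⋖ v → e ∈ E v → k = v := fun v hv hev =>
        (hv.eq_or_eq hk.le (hkmin v hv.le hev)).resolve_left hk.lt.ne'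
      have hlow : ∀ {v} (hv : x ⋖ v), v ≤ z → e ≤ lab ⟨(x, v), hv⟩ := fun hv hvz =>
        he.2 ⟨H.mono hvz (H.isLeast hv).1.1, (H.isLeast hv).1.2⟩
      have h1 := hlow h (t.le_of_mem_support hz)
      -- Equality would make both first labels equal to `e`, and both first steps would then go to
      -- the cover generated by `e`.
      have h2 : e < lab ⟨(x, u'), h'⟩ := by
        refine (h1.trans hle.1).lt_of_ne fun heq => huu ?_
        have h3 : e = lab ⟨(x, u), h⟩ := le_antisymm h1 (hle.1.trans heq.ge)
        rw [← hstep u h (h3 ▸ (H.isLeast h).1.1), ← hstep u' h' (heq ▸ (H.isLeast h').1.1)]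
      obtain ⟨w, c'', hw, hwz, hl, hs⟩ := H.exists_swap hmono hρ h' t' hz' he.1 h2
      refine ⟨w, c'', by simp [SatChain.support, hw], ?_, hl, hs⟩
      simp only [SatChain.support, List.mem_cons, not_or]
      exact ⟨fun e => SatChain.left_notMem_support h' t' (e ▸ hw),
        fun hwt => (hzmin ⟨hw, hwt⟩ hwz.le).not_gt hwz⟩

open Classical in
theorem isFacet_orderComplex_iff [Finite P] {b t : P} (hb : IsBot b) (ht : IsTop t)
    (F : Finset P) :
    IsFacet (orderComplex P) F ↔ ∃ c : SatChain b t, c.support.toFinset = F := by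
  constructor
  · rintro ⟨hF, hmax⟩
    have hmax' : ∀ z, (∀ w ∈ (F : Set P), z ≤ w ∨ w ≤ z) → z ∈ (F : Set P) := fun z hz => by
      have h : insert z F ∈ orderComplex P := by
        simp only [orderComplex, Set.mem_ofPred_eq, Finset.coe_insert]
        exact IsChain.insert hF fun w hw _ => hz w hw
      exact hmax h (Finset.subset_insert z F) (Finset.mem_insert_self z F)
    obtain ⟨c, hc⟩ := exists_satChain_of_maximal hF hmax' ht b (hmax' b fun w _ => .inl (hb w))
    refine ⟨c, ?_⟩
    ext z
    rw [List.mem_toFinset, hc]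
    exact ⟨fun h => h.1, fun h => ⟨h, hb z⟩⟩
  · rintro ⟨c, rfl⟩
    refine ⟨?_, fun K hK hcK z hz => ?_⟩
    · simpa only [orderComplex, Set.mem_ofPred_eq, List.coe_toFinset] using c.isChain_support
    · rw [List.mem_toFinset]
      refine c.mem_support_of_comparable (hb z) (ht z) fun w hw => ?_
      exact IsChain.total hK hz (hcK (List.mem_toFinset.2 hw))

/-- Facets are listed by lexicographic order of their labels. By `exists_earlier`, a face shared
with an earlier facet misses some `w`, while deleting only `w` already gives a shared face; a
maximal shared face is therefore the facet minus one vertex. -/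
theorem IsMinLabeling.isShellable [Finite P] (H : IsMinLabeling E lab) {ρ : P → ℕ}
    (hmono : StrictMono ρ) (hρ : ∀ x y, x ⋖ y → ρ y = ρ x + 1) {b t : P} (hb : IsBot b)
    (ht : IsTop t) : IsShellable P := by
  classical
  -- Recovers the chain from its set of elements. The values `none`, and `[]` for `key` below, occur
  -- only at sets that are not facets.
  let chainOf : Finset P → Option (SatChain b t) := fun F =>
    if h : ∃ c : SatChain b t, c.support.toFinset = F then some h.choose else none
  have hchain : ∀ c : SatChain b t, chainOf c.support.toFinset = some c := fun c => by
    have h : ∃ c' : SatChain b t, c'.support.toFinset = c.support.toFinset := ⟨c, rfl⟩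
    simp only [chainOf, dif_pos h, Option.some.injEq]
    refine SatChain.eq_of_support_eq _ _ fun z => ?_
    rw [← List.mem_toFinset, h.choose_spec, List.mem_toFinset]
  let key : Finset P → List Λ := fun F => ((chainOf F).map fun c => c.labels lab).getD []
  have hkey : ∀ c : SatChain b t, key c.support.toFinset = c.labels lab := fun c => by
    simp [key, hchain c]
  let r : Finset P → Finset P → Prop := fun F F' => key F ≤ key F'
  have : Std.Total r := ⟨fun F F' => le_total _ _⟩
  have : IsTrans (Finset P) r := ⟨fun _ _ _ h h' => le_trans h h'⟩
  have hfin : {F : Finset P | IsFacet (orderComplex P) F}.Finite := Set.toFinite _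
  let l := List.insertionSort r hfin.toFinset.toList
  have hperm : l.Perm hfin.toFinset.toList := List.perm_insertionSort r _
  have hmem : ∀ F, F ∈ l ↔ IsFacet (orderComplex P) F := fun F => by
    rw [hperm.mem_iff, Finset.mem_toList, Set.Finite.mem_toFinset, Set.mem_ofPred_eq]
  have hnd : l.Nodup := hperm.nodup_iff.2 (Finset.nodup_toList _)
  have hpw : l.Pairwise r := List.pairwise_insertionSort r _
  refine ⟨l, hnd, hmem, fun j _ s hs => ?_⟩
  obtain ⟨⟨hsj, i, hij, hsi⟩, hsmax⟩ := hs
  obtain ⟨c, hc⟩ := (isFacet_orderComplex_iff hb ht _).1 ((hmem _).1 (l.get_mem i))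
  obtain ⟨c', hc'⟩ := (isFacet_orderComplex_iff hb ht _).1 ((hmem _).1 (l.get_mem j))
  have hle : key (l.get i) ≤ key (l.get j) := hpw.rel_get_of_lt hij
  rw [← hc, ← hc', hkey, hkey] at hle
  have hne : c ≠ c' := fun h => by
    have : l.get i = l.get j := by rw [← hc, ← hc', h]
    exact hij.ne (hnd.injective_get this)
  obtain ⟨w, c'', hw, hw', hl, hsup⟩ := H.exists_earlier hmono hρ c c' hne (not_lt.2 hle)
  obtain ⟨k, hk⟩ := List.get_of_mem
    ((hmem _).2 ((isFacet_orderComplex_iff hb ht _).2 ⟨c'', rfl⟩))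
  have hkj : k < j := by
    by_contra hkj
    have h1 : key (l.get j) ≤ key (l.get k) := by
      rcases (not_lt.1 hkj).eq_or_lt with rfl | h
      · exact le_rfl
      · exact hpw.rel_get_of_lt h
    rw [hk, ← hc', hkey, hkey] at h1
    exact h1.not_gt hl
  have hwj : w ∈ l.get j := by rw [← hc', List.mem_toFinset]; exact hw
  have hsub : s ⊆ (l.get j).erase w := fun v hv => Finset.mem_erase.2 ⟨fun e => hw' (by
    subst e; have := hsi hv; rwa [← hc, List.mem_toFinset] at this), hsj hv⟩
  have hmem' : (l.get j).erase w ∈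
      {s | s ⊆ l.get j ∧ ∃ i : Fin l.length, i < j ∧ s ⊆ l.get i} := by
    refine ⟨Finset.erase_subset _ _, k, hkj, fun v hv => ?_⟩
    rw [hk, List.mem_toFinset]
    rw [Finset.mem_erase, ← hc', List.mem_toFinset] at hv
    exact hsup v hv.2 hv.1
  have hEq : s = (l.get j).erase w := Finset.Subset.antisymm hsub (hsmax hmem' hsub)
  rw [hEq, Finset.card_erase_add_one hwj]

end MinLabelings

/-! ### Möbius function -/

theorem mobius_eq_of_sum {P : Type} [PartialOrder P] [Fintype P] [OrderBot P]
    [DecidableLE P] [DecidableEq P] (f : P → ℤ)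
    (hf : ∀ x : P, ∑ y ∈ Finset.univ.filter (· ≤ x), f y = if x = ⊥ then 1 else 0) (x : P) :
    mobius x = f x := by
  classical
  have hm : ∀ x : P, ∑ y ∈ Finset.univ.filter (· ≤ x), mobius y = if x = ⊥ then 1 else 0 := by
    intro x
    let : LocallyFiniteOrder P := Fintype.toLocallyFiniteOrder
    have h := IncidenceAlgebra.sum_Icc_mu_right (𝕜 := ℤ) (⊥ : P) x
    have h2 : Finset.univ.filter (· ≤ x) = Finset.Icc ⊥ x := by ext; simp
    rw [h2]
    simp only [eq_comm (a := x)]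
    unfold mobius
    convert h
  induction x using WellFoundedLT.induction with
  | ind x ih =>
  have h := (hm x).trans (hf x).symm
  have hx : x ∈ Finset.univ.filter (· ≤ x) := by simp
  rw [← Finset.add_sum_erase _ _ hx, ← Finset.add_sum_erase _ f hx] at h
  rw [Finset.sum_congr rfl (g := f) fun y hy => ih y ?_] at h
  · exact add_right_cancel h
  · simp only [Finset.mem_erase, Finset.mem_filter, Finset.mem_univ, true_and] at hy
    exact hy.2.lt_of_ne hy.1

end NCBond

namespace NCBond

open SimpleGraph Relation

variable {n : ℕ}

/-! ### Perfectly labeled graphs -/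

section PerfectlyLabeled

variable {X Y : SimpleGraph (Fin n)}

theorem IsPerfectlyLabeled.of_isBond (hX : IsPerfectlyLabeled X) (hY : IsBond X Y) :
    IsPerfectlyLabeled Y := fun i j k hij hjk hik hjk' =>
  hY.2 i j (hik.reachable.trans hjk'.symm.reachable)
    (hX i j k hij hjk (hY.1 hik) (hY.1 hjk'))

/-- Reachable vertices of a perfectly labeled graph have a common descendant. -/
theorem IsPerfectlyLabeled.exists_common_descendant (hX : IsPerfectlyLabeled X) {u w : Fin n}
    (h : X.Reachable u w) :
    ∃ z, ReflTransGen (fun x y => X.Adj x y ∧ y < x) u z ∧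
      ReflTransGen (fun x y => X.Adj x y ∧ y < x) w z := by
  -- Two distinct lower neighbors of `a` are adjacent, so the larger descends to the smaller in one
  -- step; this local confluence feeds `church_rosser`.
  have hdiamond : ∀ a b c, (X.Adj a b ∧ b < a) → (X.Adj a c ∧ c < a) →
      ∃ d, ReflGen (fun x y => X.Adj x y ∧ y < x) b d ∧
        ReflTransGen (fun x y => X.Adj x y ∧ y < x) c d := by
    rintro a b c ⟨hab, hba⟩ ⟨hac, hca⟩
    rcases lt_trichotomy b c with h | rfl | h
    · exact ⟨b, .refl, .single ⟨(hX b c a h hca hab.symm hac.symm).symm, h⟩⟩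
    · exact ⟨b, .refl, .refl⟩
    · exact ⟨c, .single ⟨(hX c b a h hba hac.symm hab.symm).symm, h⟩, .refl⟩
  rw [reachable_iff_reflTransGen] at h
  induction h with
  | refl => exact ⟨u, .refl, .refl⟩
  | @tail v w _ hvw ih =>
    obtain ⟨z, hu, hv⟩ := ih
    rcases lt_or_gt_of_ne hvw.ne with hlt | hlt
    · exact ⟨z, hu, .head ⟨hvw.symm, hlt⟩ hv⟩
    · obtain ⟨d, hd, hd'⟩ := church_rosser hdiamond hv (.single ⟨hvw, hlt⟩)
      exact ⟨d, hu.trans hd, hd'⟩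

/-- The common descendant of `u` and `w` is at most `w < u`, so the descent from `u` has a first
step. -/
theorem IsPerfectlyLabeled.exists_lower_neighbor (hX : IsPerfectlyLabeled X) {u w : Fin n}
    (h : X.Reachable u w) (hw : w < u) : ∃ v, X.Adj v u ∧ v < u := by
  obtain ⟨z, hu, hz⟩ := hX.exists_common_descendant h
  have hzw : z ≤ w := by
    clear hu h
    induction hz with
    | refl => exact le_rfl
    | tail _ h ih => exact h.2.le.trans ih
  rcases hu.cases_head with rfl | ⟨v, hv, -⟩
  · exact absurd (hzw.trans_lt hw) (lt_irrefl _)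
  · exact ⟨v, hv.1.symm, hv.2⟩

/-- If `X` and `Y` have the same edges below `b`, then they have the same connectivity there. -/
theorem IsPerfectlyLabeled.reachable_of_forall_lt (hX : IsPerfectlyLabeled X) {b : Fin n}
    (hb : ∀ u v, u < v → v < b → X.Adj u v → Y.Adj u v) {u w : Fin n} (h : X.Reachable u w)
    (hu : u < b) (hw : w < b) : Y.Reachable u w := by
  have key : ∀ {u z : Fin n}, ReflTransGen (fun x y => X.Adj x y ∧ y < x) u z → u < b →
      Y.Reachable u z ∧ z < b := by
    intro u z h hu
    induction h with
    | refl => exact ⟨.refl _, hu⟩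
    | tail _ h ih =>
      exact ⟨ih.1.trans (hb _ _ h.2 ih.2 h.1.symm).symm.reachable, h.2.trans ih.2⟩
  obtain ⟨z, h1, h2⟩ := hX.exists_common_descendant h
  exact (key h1 hu).1.trans (key h2 hw).1.symm

end PerfectlyLabeled

/-! ### Minimal vertices of components -/

section ComponentMins

variable {X Y : SimpleGraph (Fin n)}

open Classical in
/-- The least vertices of the connected components. -/
noncomputable def componentMins (X : SimpleGraph (Fin n)) : Finset (Fin n) :=
  Finset.univ.filter fun v => ∀ w, X.Reachable v w → v ≤ w

theorem mem_componentMins {v : Fin n} :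
    v ∈ componentMins X ↔ ∀ w, X.Reachable v w → v ≤ w := by
  simp [componentMins]

theorem exists_componentMin (X : SimpleGraph (Fin n)) (v : Fin n) :
    ∃ r ∈ componentMins X, X.Reachable r v := by
  obtain ⟨r, hr, hmin⟩ := (Set.toFinite {w | X.Reachable v w}).exists_minimal ⟨v, .refl v⟩
  refine ⟨r, mem_componentMins.2 fun w hw => ?_, SimpleGraph.Reachable.symm hr⟩
  exact (le_total r w).elim id fun h => hmin (SimpleGraph.Reachable.trans hr hw) h

theorem cc_eq_card (X : SimpleGraph (Fin n)) : cc X = (componentMins X).card := by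
  rw [cc, ← Nat.card_eq_finsetCard]
  refine (Nat.card_congr (Equiv.ofBijective
    (fun v : componentMins X => X.connectedComponentMk v) ⟨?_, ?_⟩)).symm
  · rintro ⟨v, hv⟩ ⟨w, hw⟩ h
    have h' : X.Reachable v w := ConnectedComponent.eq.1 h
    exact Subtype.ext (le_antisymm (mem_componentMins.1 hv w h')
      (mem_componentMins.1 hw v h'.symm))
  · intro C
    induction C using ConnectedComponent.ind with
    | h v =>
    obtain ⟨r, hr, hv⟩ := exists_componentMin X v
    exact ⟨⟨r, hr⟩, ConnectedComponent.eq.2 hv⟩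

theorem cc_le (X : SimpleGraph (Fin n)) : cc X ≤ n := by
  rw [cc_eq_card]
  exact (Finset.card_le_univ _).trans (Fintype.card_fin n).le

theorem componentMins_anti (h : ∀ u v, X.Reachable u v → Y.Reachable u v) :
    componentMins Y ⊆ componentMins X := fun _ hv =>
  mem_componentMins.2 fun w hw => mem_componentMins.1 hv w (h _ _ hw)

theorem cc_anti (h : X ≤ Y) : cc Y ≤ cc X := by
  rw [cc_eq_card, cc_eq_card]
  exact Finset.card_le_card (componentMins_anti fun _ _ => .mono h)

theorem cc_congr (h : ∀ u v, X.Reachable u v ↔ Y.Reachable u v) : cc X = cc Y := by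
  rw [cc_eq_card, cc_eq_card, (componentMins_anti fun u v => (h u v).1).antisymm
    (componentMins_anti fun u v => (h u v).2)]

theorem cc_bot : cc (⊥ : SimpleGraph (Fin n)) = n := by
  rw [cc_eq_card]
  conv_rhs => rw [← Finset.card_fin n]
  congr 1
  ext v
  simp only [mem_componentMins, reachable_bot, Finset.mem_univ, iff_true]
  exact fun w h => h.le

end ComponentMins

/-! ### Bonds -/

section Bonds

variable {G F H : SimpleGraph (Fin n)}

/-- The bond of `G` with the same components as `F`. -/
def bondClosure (G F : SimpleGraph (Fin n)) : SimpleGraph (Fin n) where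
  Adj u v := G.Adj u v ∧ F.Reachable u v
  symm := ⟨fun _ _ h => ⟨h.1.symm, h.2.symm⟩⟩
  loopless := ⟨fun _ h => h.1.ne rfl⟩

theorem le_bondClosure (h : F ≤ G) : F ≤ bondClosure G F := fun _ _ huv =>
  ⟨h huv, huv.reachable⟩

theorem bondClosure_reachable (h : F ≤ G) {u v : Fin n} :
    (bondClosure G F).Reachable u v ↔ F.Reachable u v := by
  refine ⟨fun huv => ?_, fun huv => huv.mono (le_bondClosure h)⟩
  rw [reachable_iff_reflTransGen] at huv
  induction huv with
  | refl => exact .refl _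
  | tail _ h ih => exact ih.trans h.2

theorem isBond_bondClosure (h : F ≤ G) : IsBond G (bondClosure G F) :=
  ⟨fun _ _ huv => huv.1, fun _ _ huv hG => ⟨hG, (bondClosure_reachable h).1 huv⟩⟩

theorem bondClosure_le (hH : IsBond G H) (h : F ≤ H) : bondClosure G F ≤ H :=
  fun u v huv => hH.2 u v (huv.2.mono h) huv.1

theorem not_isCrossingPartition_iff :
    ¬ IsCrossingPartition H.reachableSetoid ↔ ∀ a b c d, a < b → b < c → c < d →
      H.Reachable a c → H.Reachable b d → H.Reachable a b := by
  unfold IsCrossingPartition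
  push Not
  rfl

theorem isNoncrossingBond_bondClosure (h : F ≤ G)
    (hF : ∀ a b c d, a < b → b < c → c < d → F.Reachable a c → F.Reachable b d →
      F.Reachable a b) : IsNoncrossingBond G (bondClosure G F) := by
  refine ⟨isBond_bondClosure h, not_isCrossingPartition_iff.2 ?_⟩
  simpa only [bondClosure_reachable h] using hF

theorem reachable_sup_edge {a b u v : Fin n} (h : (H ⊔ edge a b).Reachable u v) :
    H.Reachable u v ∨ ((H.Reachable u a ∨ H.Reachable u b) ∧
      (H.Reachable v a ∨ H.Reachable v b)) := by
  rw [reachable_iff_reflTransGen] at h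
  induction h with
  | refl => exact .inl (.refl _)
  | @tail v w _ hvw ih =>
    rw [sup_adj, edge_adj] at hvw
    rcases hvw with hvw | ⟨⟨rfl, rfl⟩ | ⟨rfl, rfl⟩, -⟩
    · rcases ih with ih | ⟨ih1, ih2⟩
      · exact .inl (ih.trans hvw.reachable)
      · exact .inr ⟨ih1, ih2.imp hvw.symm.reachable.trans hvw.symm.reachable.trans⟩
    · exact .inr ⟨ih.elim .inl And.left, .inr (.refl _)⟩
    · exact .inr ⟨ih.elim .inr And.left, .inl (.refl _)⟩

/-- Merging along an edge `ab` of `H' \ H` with `b` least. -/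
theorem IsNoncrossingBond.merge {H H' : SimpleGraph (Fin n)} (hG : IsPerfectlyLabeled G)
    (hH : IsNoncrossingBond G H) (hH' : IsNoncrossingBond G H') (hle : H ≤ H') {a b : Fin n}
    (hab : a < b) (hadj : H'.Adj a b) (hnadj : ¬ H.Adj a b)
    (hmin : ∀ u v, u < v → v < b → H'.Adj u v → H.Adj u v) :
    IsNoncrossingBond G (bondClosure G (H ⊔ edge a b)) ∧
      cc (bondClosure G (H ⊔ edge a b)) + 1 = cc H := by
  have hFG : H ⊔ edge a b ≤ G :=
    sup_le hH.1.1 ((edge_le_iff _).2 (.inr (hH'.1.1 hadj)))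
  have hFH' : H ⊔ edge a b ≤ H' := sup_le hle ((edge_le_iff _).2 (.inr hadj))
  have hFab : (H ⊔ edge a b).Reachable a b :=
    Adj.reachable (.inr (by rw [edge_adj]; exact ⟨.inl ⟨rfl, rfl⟩, hab.ne⟩))
  have hHF : ∀ {u v}, H.Reachable u v → (H ⊔ edge a b).Reachable u v := .mono le_sup_left
  have hHH' : ∀ {u v}, H.Reachable u v → H'.Reachable u v := .mono hle
  have hnab : ¬ H.Reachable a b := fun h => hnadj (hH.1.2 a b h (hH'.1.1 hadj))
  -- Otherwise `b` has a lower neighbor `c` in `H`. Then `a = c`, or `ac` is an edge of `H'` with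
  -- upper end below `b` and hence lies in `H`; either way `a` and `b` are connected in `H`.
  have hbmin : b ∈ componentMins H := by
    refine mem_componentMins.2 fun w hw => ?_
    by_contra hwb
    obtain ⟨c, hc, hcb⟩ := (hG.of_isBond hH.1).exists_lower_neighbor hw (not_le.1 hwb)
    rcases lt_trichotomy a c with h | rfl | h
    · exact hnab ((hmin a c h hcb ((hG.of_isBond hH'.1) a c b h hcb hadj
        (hle hc))).reachable.trans hc.reachable)
    · exact hnadj hc
    · exact hnab ((hmin c a h hab ((hG.of_isBond hH'.1) c a b h hab (hle hc)
        hadj)).reachable.symm.trans hc.reachable)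
  -- Below `b` the two graphs have the same connectivity, so the other components of `H` inside this
  -- component of `H'` lie entirely above `b`.
  have hgt : ∀ {v}, H'.Reachable v a → ¬ H.Reachable v a → ¬ H.Reachable v b → b < v := by
    intro v hv hva hvb
    by_contra hlt
    rcases (not_lt.1 hlt).eq_or_lt with rfl | hlt
    · exact hvb (.refl _)
    · exact hva ((hG.of_isBond hH'.1).reachable_of_forall_lt
        (fun u w h1 h2 h3 => hmin u w h1 h2 h3) hv hlt hab)
  have hFa : ∀ {v}, H.Reachable v a ∨ H.Reachable v b → (H ⊔ edge a b).Reachable v a :=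
    fun h => h.elim hHF fun h => (hHF h).trans hFab.symm
  have hlow : ∀ {v}, H.Reachable v a ∨ H.Reachable v b → ∃ y ≤ b, H.Reachable y v :=
    fun h => h.elim (fun h => ⟨a, hab.le, h.symm⟩) fun h => ⟨b, le_rfl, h.symm⟩
  have hncH := not_isCrossingPartition_iff.1 hH.2
  have hncH' := not_isCrossingPartition_iff.1 hH'.2
  constructor
  -- A new crossing would involve the merged block and another block, which by `hgt` lies above `b`.
  -- Each half of the merged block has a vertex `y ≤ b`; replacing a suitable vertex of the crossing
  -- by `y` produces a crossing already in `H`.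
  · refine isNoncrossingBond_bondClosure hFG fun x₁ x₂ x₃ x₄ h12 h23 h34 h13 h24 => ?_
    have h12' := hncH' _ _ _ _ h12 h23 h34 (h13.mono hFH') (h24.mono hFH')
    by_contra hne
    rcases reachable_sup_edge h13 with h13' | ⟨h1, h3⟩
    · rcases reachable_sup_edge h24 with h24' | ⟨h2, -⟩
      · exact hne (hHF (hncH _ _ _ _ h12 h23 h34 h13' h24'))
      · have hx1 : ¬ (H.Reachable x₁ a ∨ H.Reachable x₁ b) := fun h =>
          hne ((hFa h).trans (hFa h2).symm)
        rw [not_or] at hx1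
        have hlt : b < x₁ := hgt (h12'.trans ((hFa h2).mono hFH')) hx1.1 hx1.2
        obtain ⟨y, hyb, hy⟩ := hlow h2
        have := hncH _ _ _ _ (hyb.trans_lt hlt) h12 h23 hy h13'
        exact hne (hHF (this.symm.trans hy))
    · rcases reachable_sup_edge h24 with h24' | ⟨h2, -⟩
      · have hx2 : ¬ (H.Reachable x₂ a ∨ H.Reachable x₂ b) := fun h =>
          hne ((hFa h1).trans (hFa h).symm)
        rw [not_or] at hx2
        have hlt : b < x₂ := hgt (h12'.symm.trans ((hFa h1).mono hFH')) hx2.1 hx2.2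
        obtain ⟨y, hyb, hy⟩ := hlow h3
        have := hncH _ _ _ _ (hyb.trans_lt hlt) h23 h34 hy h24'
        exact hne ((hFa h1).trans ((hFa h3).symm.trans (hHF (hy.symm.trans this))))
      · exact hne ((hFa h1).trans (hFa h2).symm)
  · rw [cc_congr (fun u v => bondClosure_reachable hFG), cc_eq_card, cc_eq_card,
      ← Finset.card_erase_add_one hbmin]
    congr 2
    -- The merge removes exactly `b` from the component minima, since the minimum of the component
    -- of `a` is at most `a < b`.
    ext v
    rw [Finset.mem_erase]
    constructor
    · intro hv
      refine ⟨?_, componentMins_anti (fun _ _ => hHF) hv⟩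
      rintro rfl
      exact absurd (mem_componentMins.1 hv a hFab.symm) hab.not_ge
    · rintro ⟨hvb, hv⟩
      have hvb' : ¬ H.Reachable v b := fun h => hvb
        (le_antisymm (mem_componentMins.1 hv b h) (mem_componentMins.1 hbmin v h.symm))
      refine mem_componentMins.2 fun w hw => ?_
      rcases reachable_sup_edge hw with hw | ⟨h1, h2⟩
      · exact mem_componentMins.1 hv w hw
      · have hva := h1.resolve_right hvb'
        rcases h2 with h2 | h2
        · exact mem_componentMins.1 hv w (hva.trans h2.symm)
        · exact (mem_componentMins.1 hv a hva).trans
            (hab.le.trans (mem_componentMins.1 hbmin w h2.symm))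

end Bonds

/-! ### The poset of noncrossing bonds -/

section NCPoset

variable {G : SimpleGraph (Fin n)}

/-- The edges of a bond, as labels. -/
def bondEdges (H : NC G) : Set (ColexEdge G) := {e | e.1 ∈ H.1.edgeSet}

theorem coe_newEdges (H H' : NC G) :
    (newEdges H H' : Set (ColexEdge G)) = bondEdges H' \ bondEdges H := by
  classical
  ext e
  rw [newEdges, Finset.mem_coe, Finset.mem_filter]
  exact ⟨fun h => h.2, fun h => ⟨Finset.mem_univ _, h⟩⟩

theorem isLeast_min'_newEdges {H H' : NC G} (h : H < H') :
    IsLeast (bondEdges H' \ bondEdges H) ((newEdges H H').min' (newEdges_nonempty h)) := by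
  rw [← coe_newEdges]
  exact Finset.isLeast_min' _ _

theorem colexKey_lt_of_lt {a b u v : Fin n} (hab : a < b) (huv : u < v) (h : v < b) :
    colexKey s(u, v) < colexKey s(a, b) := by
  have h1 : colexKey s(u, v) = toLex (v, u) := by
    simp [colexKey, Sym2.sup_mk, Sym2.inf_mk, huv.le]
  have h2 : colexKey s(a, b) = toLex (b, a) := by
    simp [colexKey, Sym2.sup_mk, Sym2.inf_mk, hab.le]
  rw [h1, h2, Prod.Lex.toLex_lt_toLex]
  exact .inl h

theorem exists_min_edge {H H' : NC G} {e : ColexEdge G}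
    (he : IsLeast (bondEdges H' \ bondEdges H) e) :
    ∃ a b, e.1 = s(a, b) ∧ a < b ∧ H'.1.Adj a b ∧ ¬ H.1.Adj a b ∧
      ∀ u v, u < v → v < b → H'.1.Adj u v → H.1.Adj u v := by
  obtain ⟨⟨he1, he2⟩, hmin⟩ := he
  obtain ⟨a, b, hab, he⟩ : ∃ a b, a < b ∧ e.1 = s(a, b) := by
    obtain ⟨e, heG⟩ := e
    induction e using Sym2.ind with
    | _ a b =>
    rcases lt_or_gt_of_ne (G.ne_of_adj heG) with h | h
    · exact ⟨a, b, h, rfl⟩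
    · exact ⟨b, a, h, Sym2.eq_swap⟩
  have he1' : e.1 ∈ H'.1.edgeSet := he1
  have he2' : e.1 ∉ H.1.edgeSet := he2
  rw [he] at he1' he2'
  refine ⟨a, b, he, hab, he1', he2', fun u v huv hvb hadj => ?_⟩
  by_contra hn
  let f : ColexEdge G := ⟨s(u, v), H'.2.1.1 hadj⟩
  have h1 : e ≤ f := hmin ⟨hadj, hn⟩
  have h2 : colexKey e.1 ≤ colexKey s(u, v) := h1
  rw [he] at h2
  exact h2.not_gt (colexKey_lt_of_lt hab huv hvb)

/-- The element `K` is the bond closure of `H` with its least new edge added. Stating `cc K + 1 = cc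
H` rather than `H ⋖ K` first gives strict antitonicity of `cc`, from which the cover relation
follows. -/
theorem exists_least_cover (hG : IsPerfectlyLabeled G) {H H' : NC G} (h : H < H') :
    ∃ (e : ColexEdge G) (K : NC G), IsLeast (bondEdges H' \ bondEdges H) e ∧ H < K ∧ K ≤ H' ∧
      e ∈ bondEdges K ∧ (∀ L : NC G, H ≤ L → e ∈ bondEdges L → K ≤ L) ∧
      cc K.1 + 1 = cc H.1 := by
  have he := isLeast_min'_newEdges h
  set e := (newEdges H H').min' (newEdges_nonempty h)
  obtain ⟨a, b, heq, hab, hadj, hnadj, hmin⟩ := exists_min_edge he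
  obtain ⟨hK, hcc⟩ := H.2.merge hG H'.2 h.le hab hadj hnadj hmin
  have hFle : ∀ L : SimpleGraph (Fin n), H.1 ≤ L → L.Adj a b → H.1 ⊔ edge a b ≤ L :=
    fun L h1 h2 => sup_le h1 ((edge_le_iff _).2 (.inr h2))
  have hFG := hFle G H.2.1.1 (H'.2.1.1 hadj)
  have heK : (bondClosure G (H.1 ⊔ edge a b)).Adj a b := le_bondClosure hFG
    (.inr (by rw [edge_adj]; exact ⟨.inl ⟨rfl, rfl⟩, hab.ne⟩))
  have hHK : H.1 ≤ bondClosure G (H.1 ⊔ edge a b) := le_sup_left.trans (le_bondClosure hFG)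
  refine ⟨e, ⟨_, hK⟩, he, ?_, bondClosure_le H'.2.1 (hFle _ h.le hadj), ?_, ?_, hcc⟩
  · refine lt_of_le_of_ne hHK fun h => hnadj ?_
    rw [h]
    exact heK
  · change e.1 ∈ (bondClosure G (H.1 ⊔ edge a b)).edgeSet
    rw [heq]
    exact heK
  · intro L hL heL
    have heL' : e.1 ∈ L.1.edgeSet := heL
    rw [heq] at heL'
    exact bondClosure_le L.2.1 (hFle _ hL heL')

theorem cc_lt_of_lt (hG : IsPerfectlyLabeled G) {H H' : NC G} (h : H < H') :
    cc H'.1 < cc H.1 := by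
  obtain ⟨e, K, -, -, hK, -, -, hcc⟩ := exists_least_cover hG h
  have := cc_anti (show K.1 ≤ H'.1 from hK)
  omega

theorem cc_of_covBy (hG : IsPerfectlyLabeled G) {H H' : NC G} (h : H ⋖ H') :
    cc H'.1 + 1 = cc H.1 := by
  obtain ⟨e, K, -, hHK, hK, -, -, hcc⟩ := exists_least_cover hG h.lt
  obtain rfl := (h.eq_or_eq hHK.le hK).resolve_left hHK.ne'
  exact hcc

theorem strictMono_sub_cc (hG : IsPerfectlyLabeled G) :
    StrictMono fun H : NC G => n - cc H.1 := fun H H' h => by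
  have := cc_lt_of_lt hG h
  have := cc_le H.1
  change n - cc H.1 < n - cc H'.1
  omega

theorem sub_cc_of_covBy (hG : IsPerfectlyLabeled G) (H H' : NC G) (h : H ⋖ H') :
    n - cc H'.1 = n - cc H.1 + 1 := by
  have := cc_of_covBy hG h
  have := cc_le H.1
  omega

theorem isMinLabeling_minLabeling (hG : IsPerfectlyLabeled G) :
    IsMinLabeling bondEdges (minLabeling G) where
  mono H H' h e he := edgeSet_mono (show H.1 ≤ H'.1 from h) he
  isLeast h := isLeast_min'_newEdges h.lt
  exists_covBy H H' h := by
    obtain ⟨e, K, he, hHK, hK, heK, hmin, hcc⟩ := exists_least_cover hG h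
    refine ⟨e, K, he, ⟨hHK, fun L h1 h2 => ?_⟩, hK, heK, hmin⟩
    have := cc_lt_of_lt hG h1
    have := cc_lt_of_lt hG h2
    omega

theorem rank_eq (hG : IsPerfectlyLabeled G) (H : NC G) : rank H = n - cc H.1 :=
  height_eq_of_covBy (strictMono_sub_cc hG) (sub_cc_of_covBy hG)
    (by rw [show (⊥ : NC G).1 = ⊥ from rfl, cc_bot, Nat.sub_self]) H

theorem isNoncrossingBond_of_adj {a b : Fin n} (hab : a < b) (h : G.Adj a b) :
    IsNoncrossingBond G (bondClosure G (edge a b)) := by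
  have hr : ∀ {u v}, (edge a b).Reachable u v → u = v ∨ ((u = a ∨ u = b) ∧ (v = a ∨ v = b)) := by
    intro u v huv
    rw [← bot_sup_eq (edge a b)] at huv
    have := reachable_sup_edge huv
    simpa only [reachable_bot] using this
  refine isNoncrossingBond_bondClosure ((edge_le_iff _).2 (.inr h)) ?_
  intro x₁ x₂ x₃ x₄ h12 h23 h34 h13 h24
  have h1 := hr h13
  have h2 := hr h24
  exfalso
  omega

/-- Every single edge of `G` spans a noncrossing bond, so a maximum must contain all of them. -/
theorem eq_of_isTop {T : NC G} (hT : IsTop T) : T.1 = G := by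
  refine le_antisymm T.2.1.1 fun u v huv => ?_
  wlog hlt : u < v generalizing u v
  · exact (this v u huv.symm (lt_of_le_of_ne (not_lt.1 hlt) huv.ne')).symm
  have h : bondClosure G (edge u v) ≤ T.1 := hT ⟨_, isNoncrossingBond_of_adj hlt huv⟩
  exact h ⟨huv, Adj.reachable (by rw [edge_adj]; exact ⟨.inl ⟨rfl, rfl⟩, hlt.ne⟩)⟩

theorem posetRank_eq (hG : IsPerfectlyLabeled G) {T : NC G} (hT : IsTop T) :
    posetRank (NC G) = n - cc G := by
  refine le_antisymm (Finset.sup_le fun H _ => ?_) ?_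
  · rw [rank_eq hG]
    have := cc_anti H.2.1.1
    omega
  · have h := rank_eq hG T
    rw [eq_of_isTop hT] at h
    rw [← h]
    exact Finset.le_sup (f := (rank : NC G → ℕ)) (Finset.mem_univ T)

end NCPoset
/-! ### Edge sets with at most one descent at each vertex -/

section Descents

variable {X F : SimpleGraph (Fin n)}

/-- Every vertex is the upper end of at most one edge. -/
def HasUniqueDescents (S : Set (Sym2 (Fin n))) : Prop :=
  ∀ i j k, i < k → j < k → s(i, k) ∈ S → s(j, k) ∈ S → i = j

theorem exists_two_neighbors_of_isCycle {v u : Fin n} {p : X.Walk v v} (hp : p.IsCycle)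
    (hu : u ∈ p.support) : ∃ x y, x ≠ y ∧ s(x, u) ∈ p.edges ∧ s(y, u) ∈ p.edges := by
  have hq := hp.rotate hu
  have hnil : ¬ (p.rotate u hu).Nil := hq.not_nil
  refine ⟨_, _, hq.snd_ne_penultimate, ?_, ?_⟩
  · rw [← (p.rotate_edges u hu).mem_iff, Sym2.eq_swap]
    exact Walk.mk_start_snd_mem_edges hnil
  · rw [← (p.rotate_edges u hu).mem_iff]
    exact Walk.mk_penultimate_end_mem_edges hnil

/-- The largest vertex of a cycle is the upper end of two of its edges, and some edge of the cycle
avoids it. -/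
theorem exists_peak_of_isCycle {v : Fin n} {p : X.Walk v v} (hp : p.IsCycle) :
    ∃ i j k, i ≠ j ∧ i < k ∧ j < k ∧ s(i, k) ∈ p.edges ∧ s(j, k) ∈ p.edges ∧
      ∃ x y, x < y ∧ y < k ∧ s(x, y) ∈ p.edges := by
  obtain ⟨k, hk, hmax⟩ := (p.support.finite_toSet).exists_maximal ⟨v, p.start_mem_support⟩
  have hlt : ∀ {x y}, s(x, y) ∈ p.edges → x ≠ k → x < k := fun {x y} h hx =>
    lt_of_le_of_ne ((le_total x k).elim id
      fun h' => hmax (p.fst_mem_support_of_mem_edges h) h') hx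
  obtain ⟨i, j, hij, hi, hj⟩ := exists_two_neighbors_of_isCycle hp hk
  have hik := hlt hi (p.adj_of_mem_edges hi).ne
  have hjk := hlt hj (p.adj_of_mem_edges hj).ne
  obtain ⟨x, y, hxy, hx, hy⟩ :=
    exists_two_neighbors_of_isCycle hp (p.fst_mem_support_of_mem_edges hi)
  obtain ⟨z, hzk, hz⟩ : ∃ z, z ≠ k ∧ s(z, i) ∈ p.edges := by
    by_cases hxk : x = k
    · exact ⟨y, fun h => hxy (hxk.trans h.symm), hy⟩
    · exact ⟨x, hxk, hx⟩
  have hzk' := hlt hz hzk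
  refine ⟨i, j, k, hij, hik, hjk, hi, hj, ?_⟩
  rcases lt_or_gt_of_ne (p.adj_of_mem_edges hz).ne with h | h
  · exact ⟨z, i, h, hik, hz⟩
  · exact ⟨i, z, h, hzk', Sym2.eq_swap ▸ hz⟩

/-- Two edges `ik`, `jk` with `i < j < k` form a broken circuit of the triangle closed by `ij`.
Conversely, the largest vertex of a cycle is the upper end of two of its edges, and neither is
colex-least because some edge of the cycle avoids that vertex; both survive in the broken circuit.
-/
theorem isNBC_iff (hX : IsPerfectlyLabeled X) (S : Finset (Sym2 (Fin n))) :
    IsNBC X S ↔ (S : Set (Sym2 (Fin n))) ⊆ X.edgeSet ∧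
      HasUniqueDescents (S : Set (Sym2 (Fin n))) := by
  refine and_congr_right fun hSX => ⟨fun h => ?_, ?_⟩
  · have key : ∀ i j k, i < j → j < k → s(i, k) ∈ S → s(j, k) ∈ S → False := by
      intro i j k hij hjk hi hj
      have hik : X.Adj i k := hSX hi
      have hjk' : X.Adj j k := hSX hj
      have hadj := hX i j k hij hjk hik hjk'
      refine h (({s(i, j), s(j, k), s(k, i)} : Finset (Sym2 (Fin n))).erase s(i, j)) ?_ ?_
      · refine ⟨i, .cons hadj (.cons hjk' (.cons hik.symm .nil)), ?_, s(i, j), by simp, ?_, ?_⟩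
        · rw [Walk.cons_isCycle_iff]
          simp [Walk.isPath_def, hij.ne', hjk.ne, (hij.trans hjk).ne', hij.ne, (hij.trans hjk).ne]
        · intro f hf
          simp only [Walk.edges_cons, Walk.edges_nil, List.mem_cons, List.not_mem_nil,
            or_false] at hf
          rcases hf with rfl | rfl | rfl
          · exact le_rfl
          · exact (colexKey_lt_of_lt hjk hij hjk).le
          · rw [Sym2.eq_swap (a := k)]
            exact (colexKey_lt_of_lt (hij.trans hjk) hij hjk).le
        · simp
      · intro e he
        simp only [Finset.mem_erase, Finset.mem_insert, Finset.mem_singleton] at he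
        rcases he with ⟨h1, rfl | rfl | rfl⟩
        · exact absurd rfl h1
        · exact hj
        · rw [Sym2.eq_swap]; exact hi
    intro i j k hik hjk hi hj
    rcases lt_trichotomy i j with h | h | h
    · exact (key i j k h hjk hi hj).elim
    · exact h
    · exact (key j i k h hik hj hi).elim
  · rintro h B ⟨v, p, hp, e, he, hmin, rfl⟩ hB
    obtain ⟨i, j, k, hij, hik, hjk, hi, hj, x, y, hxy, hyk, hxy'⟩ := exists_peak_of_isCycle hp
    have hne : ∀ {i}, i < k → s(i, k) ≠ e := by
      rintro i hik rfl
      exact (hmin _ hxy').not_gt (colexKey_lt_of_lt hik hxy hyk)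
    have hmem : ∀ {i}, i < k → s(i, k) ∈ p.edges → s(i, k) ∈ S := fun hik hi =>
      hB (Finset.mem_erase.2 ⟨hne hik, List.mem_toFinset.2 hi⟩)
    exact hij (h i j k hik hjk (hmem hik hi) (hmem hjk hj))

theorem HasUniqueDescents.isAcyclic (h : HasUniqueDescents F.edgeSet) : F.IsAcyclic := by
  intro v p hp
  obtain ⟨i, j, k, hij, hik, hjk, hi, hj, -⟩ := exists_peak_of_isCycle hp
  exact hij (h i j k hik hjk (p.edges_subset_edgeSet hi) (p.edges_subset_edgeSet hj))

theorem HasUniqueDescents.isPerfectlyLabeled (h : HasUniqueDescents F.edgeSet) :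
    IsPerfectlyLabeled F := fun i j k hij hjk hik hjk' =>
  absurd (h i j k (hij.trans hjk) hjk hik hjk') hij.ne

/-- A path that goes up once can never turn down: the turning vertex would be the upper end of two
different edges. -/
theorem HasUniqueDescents.isChain_support (h : HasUniqueDescents F.edgeSet) {u w v : Fin n}
    (huw : F.Adj u w) (p : F.Walk w v) (hp : (Walk.cons huw p).IsPath) (hlt : u < w) :
    (Walk.cons huw p).support.IsChain (· < ·) := by
  induction p generalizing u with
  | nil => simpa using hlt
  | @cons w x v hwx p ih =>
    rw [Walk.support_cons]
    have hux : u ≠ x := by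
      rintro rfl
      simp [Walk.cons_isPath_iff] at hp
    have hwx' : w < x := by
      by_contra hn
      have hxw : x < w := lt_of_le_of_ne (not_lt.1 hn) hwx.ne'
      exact hux (h u x w hlt hxw huw hwx.symm)
    have := ih hwx hp.of_cons hwx'
    rw [Walk.support_cons] at this ⊢
    exact List.isChain_cons_cons.2 ⟨hlt, this⟩

theorem le_end_of_isChain_support {u v w : Fin n} (p : F.Walk u v)
    (hp : p.support.IsChain (· < ·)) (hw : w ∈ p.support) : w ≤ v := by
  induction p with
  | nil => simp only [Walk.support_nil, List.mem_singleton] at hw; exact hw.le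
  | @cons u x v h p ih =>
    rw [List.isChain_iff_pairwise, Walk.support_cons, List.pairwise_cons] at hp
    rw [Walk.support_cons, List.mem_cons] at hw
    rcases hw with rfl | hw
    · exact (hp.1 v p.end_mem_support).le
    · exact ih (List.isChain_iff_pairwise.2 hp.2) hw

theorem isIncreasingSpanningForest_iff :
    IsIncreasingSpanningForest X F ↔ F ≤ X ∧ HasUniqueDescents F.edgeSet := by
  refine and_congr_right fun _ => ⟨?_, fun h => ⟨h.isAcyclic, ?_⟩⟩
  · rintro ⟨hac, hinc⟩ i j k hik hjk hi hj
    have hi' : F.Adj i k := hi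
    have hj' : F.Adj j k := hj
    obtain ⟨r, hr, hri⟩ := exists_componentMin F i
    rw [mem_componentMins] at hr
    obtain ⟨p, hp⟩ := hri.exists_isPath
    obtain ⟨q, hq⟩ := ((hri.trans hi'.reachable).trans hj'.symm.reachable).exists_isPath
    -- The increasing paths from the root to `i` and `j` end at their largest vertices, so `k` is on
    -- neither and both extend to paths to `k`. Acyclicity identifies these, and `i`, `j` are their
    -- penultimate vertices.
    have hpk := hp.concat (fun hk => (le_end_of_isChain_support p (hinc r i p hr hp) hk).not_gt hik)
      hi'
    have hqk := hq.concat (fun hk => (le_end_of_isChain_support q (hinc r j q hr hq) hk).not_gt hjk)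
      hj'
    have heq := congrArg Subtype.val ((hac.subsingleton_path r k).elim ⟨_, hpk⟩ ⟨_, hqk⟩)
    have := congrArg Walk.penultimate heq
    simpa only [Walk.penultimate_concat] using this
  · intro r v p hr hp
    cases p with
    | nil => simp
    | cons hrw p =>
      exact h.isChain_support hrw p hp (lt_of_le_of_ne (hr _ hrw.reachable) hrw.ne)

/-- Sending an edge to its upper end is a bijection onto the vertices that are not least in their
component. -/
theorem HasUniqueDescents.card_edges {S : Finset (Sym2 (Fin n))}
    (hS : (S : Set (Sym2 (Fin n))) = F.edgeSet) (h : HasUniqueDescents F.edgeSet) :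
    S.card = n - cc F := by
  have hmem : ∀ e, e ∈ S ↔ e ∈ F.edgeSet := fun e => by rw [← hS, Finset.mem_coe]
  have hform : ∀ e ∈ S, ∃ i k, i < k ∧ e = s(i, k) ∧ e.sup = k ∧ F.Adj i k := by
    intro e he
    rw [hmem] at he
    induction e using Sym2.ind with
    | _ a b =>
    have hab : F.Adj a b := he
    rcases lt_or_gt_of_ne hab.ne with h | h
    · exact ⟨a, b, h, rfl, by simp [h.le], hab⟩
    · exact ⟨b, a, h, Sym2.eq_swap, by simp [h.le], hab.symm⟩
  have hcard : S.card = (Finset.univ \ componentMins F).card := by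
    refine Finset.card_bij (fun e _ => e.sup) ?_ ?_ ?_
    · intro e he
      obtain ⟨i, k, hik, -, hk, hadj⟩ := hform e he
      simp only [hk, Finset.mem_sdiff, Finset.mem_univ, true_and, mem_componentMins]
      exact fun hmin => (hmin i hadj.symm.reachable).not_gt hik
    · intro e he f hf hef
      obtain ⟨i, k, hik, rfl, hk, hadj⟩ := hform e he
      obtain ⟨j, l, hjl, rfl, hl, hadj'⟩ := hform f hf
      obtain rfl : k = l := hk.symm.trans (hef.trans hl)
      rw [h i j k hik hjl hadj hadj']
    · intro v hv
      simp only [Finset.mem_sdiff, Finset.mem_univ, true_and, mem_componentMins, not_forall,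
        not_le] at hv
      obtain ⟨w, hw, hlt⟩ := hv
      obtain ⟨u, hu, huv⟩ := h.isPerfectlyLabeled.exists_lower_neighbor hw hlt
      exact ⟨s(u, v), (hmem _).2 hu, by simp [huv.le]⟩
  rw [hcard, Finset.card_univ_sdiff, Fintype.card_fin, cc_eq_card]

end Descents

/-! ### Noncrossing edge sets -/

section Noncrossing

/-- A graph without crossing edges has noncrossing components. -/
theorem reachable_of_not_edgesCross {F : SimpleGraph (Fin n)}
    (hF : ∀ e ∈ F.edgeSet, ∀ f ∈ F.edgeSet, ¬ EdgesCross e f) {a b c d : Fin n} (hab : a < b)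
    (hbc : b < c) (hcd : c < d) (hac : F.Reachable a c) (hbd : F.Reachable b d) :
    F.Reachable a b := by
  by_contra hn
  have hcross : ∀ {x y z w}, x < y → y < z → z < w → F.Adj x z → F.Adj y w → False :=
    fun h1 h2 h3 h4 h5 => hF _ h4 _ h5 ⟨_, _, _, _, h1, h2, h3, .inl ⟨rfl, rfl⟩⟩
  have hstep : ∀ {s t : Fin n} (T : Set (Fin n)), F.Reachable s t → s ∈ T → t ∉ T →
      ∃ x y, F.Reachable s x ∧ F.Adj x y ∧ x ∈ T ∧ y ∉ T := by
    intro s t T hst hs ht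
    obtain ⟨p⟩ := hst
    obtain ⟨δ, -, h1, h2⟩ := p.exists_boundary_dart {x | F.Reachable s x ∧ x ∈ T}
      ⟨.refl _, hs⟩ fun h => ht h.2
    exact ⟨δ.fst, δ.snd, h1.1, δ.adj, h1.2, fun h => h2 ⟨h1.1.trans δ.adj.reachable, h⟩⟩
  -- The walk from `a` to `c` enters the open interval `(b, d)` along an edge `uv`, which then
  -- separates `b` from `d`. The walk from `b` to `d`, in another component, must pass from one side
  -- of `uv` to the other along an edge crossing it.
  obtain ⟨u, v, hau, huv, hu, hv⟩ := hstep {x | ¬ (b < x ∧ x < d)} hac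
    (fun h => hab.not_gt h.1) (fun h => h ⟨hbc, hcd⟩)
  simp only [Set.mem_ofPred_eq, not_not] at hu hv
  have hne : ∀ {x y}, F.Reachable a x → F.Reachable b y → x ≠ y := by
    rintro x _ hx hy rfl
    exact hn (hx.trans hy.symm)
  have hav := hau.trans huv.reachable
  have hub := hne hau (.refl b)
  have hud := hne hau hbd
  rcases lt_or_gt_of_ne hub with hub | hub
  · obtain ⟨x, y, hbx, hxy, hx, hy⟩ := hstep {x | u < x ∧ x < v} hbd ⟨hub, hv.1⟩
      (fun h => hv.2.not_gt h.2)
    have hby := hbx.trans hxy.reachable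
    simp only [Set.mem_ofPred_eq, not_and, not_lt] at hx hy
    rcases lt_or_gt_of_ne (hne hau hby) with h | h
    · exact hcross hx.1 hx.2 (lt_of_le_of_ne (hy h) (hne hav hby)) huv hxy
    · exact hcross h hx.1 hx.2 hxy.symm huv
  · have hdu : d < u := by
      by_contra h
      exact hu ⟨hub, lt_of_le_of_ne (not_lt.1 h) hud⟩
    obtain ⟨x, y, hbx, hxy, hx, hy⟩ := hstep {x | ¬ (v < x ∧ x < u)} hbd
      (fun h => hv.1.not_gt h.1) (fun h => h ⟨hv.2, hdu⟩)
    simp only [Set.mem_ofPred_eq, not_not] at hx hy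
    rcases lt_or_gt_of_ne (hne hav hbx) with h | h
    · have hux : u < x := lt_of_le_of_ne (not_lt.1 fun h' => hx ⟨h, h'⟩) (hne hau hbx)
      exact hcross hy.1 hy.2 hux huv.symm hxy.symm
    · exact hcross h hy.1 hy.2 hxy huv.symm

open Classical in
/-- The edge sets of the noncrossing increasing spanning forests of `X`. -/
noncomputable def noncrossingForests (X : SimpleGraph (Fin n)) :
    Finset (Finset (Sym2 (Fin n))) :=
  Finset.univ.filter fun S => (S : Set (Sym2 (Fin n))) ⊆ X.edgeSet ∧
    HasUniqueDescents (S : Set (Sym2 (Fin n))) ∧ ∀ e ∈ S, ∀ f ∈ S, ¬ EdgesCross e f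

variable {X : SimpleGraph (Fin n)} {S : Finset (Sym2 (Fin n))}

theorem mem_noncrossingForests : S ∈ noncrossingForests X ↔
    (S : Set (Sym2 (Fin n))) ⊆ X.edgeSet ∧ HasUniqueDescents (S : Set (Sym2 (Fin n))) ∧
      ∀ e ∈ S, ∀ f ∈ S, ¬ EdgesCross e f := by
  simp [noncrossingForests]

/-- The graph with edge set `S`. -/
def forestGraph (S : Finset (Sym2 (Fin n))) : SimpleGraph (Fin n) :=
  fromEdgeSet (S : Set (Sym2 (Fin n)))

theorem edgeSet_forestGraph (hS : S ∈ noncrossingForests X) :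
    (forestGraph S).edgeSet = (S : Set (Sym2 (Fin n))) := by
  rw [forestGraph, edgeSet_fromEdgeSet, sdiff_eq_left, Set.disjoint_left]
  exact fun e he hd => X.not_isDiag_of_mem_edgeSet ((mem_noncrossingForests.1 hS).1 he) hd

theorem forestGraph_le (hS : S ∈ noncrossingForests X) : forestGraph S ≤ X := by
  rw [← edgeSet_subset_edgeSet, edgeSet_forestGraph hS]
  exact (mem_noncrossingForests.1 hS).1

theorem card_eq_sub_cc (hS : S ∈ noncrossingForests X) : S.card = n - cc (forestGraph S) := by
  have hes := edgeSet_forestGraph hS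
  exact HasUniqueDescents.card_edges hes.symm (hes ▸ (mem_noncrossingForests.1 hS).2.1)

theorem isNoncrossingBond_of_mem_noncrossingForests (hS : S ∈ noncrossingForests X) :
    IsNoncrossingBond X (bondClosure X (forestGraph S)) := by
  refine isNoncrossingBond_bondClosure (forestGraph_le hS) fun a b c d => ?_
  refine reachable_of_not_edgesCross ?_
  rw [edgeSet_forestGraph hS]
  exact (mem_noncrossingForests.1 hS).2.2

theorem ncnbc_eq_card (hX : IsPerfectlyLabeled X) (k : ℕ) :
    ncnbc k X = ((noncrossingForests X).filter fun S => S.card = k).card := by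
  rw [ncnbc, ← Set.ncard_coe_finset]
  congr 1
  ext S
  simp only [Finset.coe_filter, mem_noncrossingForests, Set.mem_ofPred_eq, isNBC_iff hX, and_assoc]

theorem ncisf_eq_card (X : SimpleGraph (Fin n)) (k : ℕ) :
    ncisf k X = ((noncrossingForests X).filter fun S => S.card = k).card := by
  rw [ncisf, ← Set.ncard_coe_finset]
  refine Set.ncard_congr (fun F _ => (Set.toFinite F.edgeSet).toFinset) ?_ ?_ ?_
  · rintro F ⟨hF, hnc, hk⟩
    rw [isIncreasingSpanningForest_iff] at hF
    simp only [Finset.coe_filter, mem_noncrossingForests, Set.mem_ofPred_eq,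
      Set.Finite.coe_toFinset, Set.Finite.mem_toFinset]
    refine ⟨⟨edgeSet_mono hF.1, hF.2, hnc⟩, ?_⟩
    rw [← hk, Set.ncard_eq_toFinset_card]
  · intro F F' _ _ h
    exact edgeSet_inj.1 (Set.Finite.toFinset_inj.1 h)
  · intro S hS
    simp only [Finset.coe_filter, Set.mem_ofPred_eq] at hS
    obtain ⟨hS, hk⟩ := hS
    have hes := edgeSet_forestGraph hS
    have hle := forestGraph_le hS
    rw [mem_noncrossingForests] at hS
    refine ⟨forestGraph S, ⟨?_, ?_, ?_⟩, ?_⟩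
    · rw [isIncreasingSpanningForest_iff, hes]
      exact ⟨hle, hS.2.1⟩
    · rw [hes]; exact hS.2.2
    · rw [hes, Set.ncard_coe_finset, hk]
    · ext e
      rw [Set.Finite.mem_toFinset, hes, Finset.mem_coe]

end Noncrossing
/-! ### The Möbius function and the characteristic polynomial -/

section Moebius

variable {G : SimpleGraph (Fin n)}

theorem exists_adj_of_ne_bot {H : SimpleGraph (Fin n)} (h : H ≠ ⊥) :
    ∃ a b, a < b ∧ H.Adj a b ∧ ∀ u v, u < v → H.Adj u v → b ≤ v := by
  obtain ⟨x, y, hxy⟩ := ne_bot_iff_exists_adj.1 h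
  have hne : {v | ∃ u, u < v ∧ H.Adj u v}.Nonempty := by
    rcases lt_or_gt_of_ne hxy.ne with h | h
    · exact ⟨y, x, h, hxy⟩
    · exact ⟨x, y, h, hxy.symm⟩
  obtain ⟨b, ⟨a, hab, hadj⟩, hmin⟩ := (Set.toFinite _).exists_minimal hne
  exact ⟨a, b, hab, hadj, fun u v huv h =>
    (le_total b v).elim id fun hvb => hmin ⟨u, huv, h⟩ hvb⟩

/-- Toggling an edge with least upper end cancels the forests of `H` in pairs. -/
theorem sum_noncrossingForests_eq_zero {H : SimpleGraph (Fin n)} (hH : IsPerfectlyLabeled H)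
    (hnc : ¬ IsCrossingPartition H.reachableSetoid) (hne : H ≠ ⊥) :
    ∑ S ∈ noncrossingForests H, (-1 : ℤ) ^ S.card = 0 := by
  obtain ⟨a, b, hab, hadj, hmin⟩ := exists_adj_of_ne_bot hne
  -- A second lower neighbor of `b` would be adjacent to `a`, giving an edge with upper end below
  -- `b`.
  have huniq : ∀ c, c < b → H.Adj c b → c = a := by
    intro c hcb hc
    rcases lt_trichotomy c a with h | h | h
    · exact absurd (hmin _ _ h (hH c a b h hab hc hadj)) hab.not_ge
    · exact h
    · exact absurd (hmin _ _ h (hH a c b h hcb hadj hc)) hcb.not_ge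
  -- If the crossing edge starts inside `(a, b)` at `y`, then noncrossing components connect `y` to
  -- `a`, so `y < b` is itself the upper end of an edge. If it ends inside, its own upper end is
  -- below `b`. Both contradict minimality of `b`.
  have hcross : ∀ f ∈ H.edgeSet, ¬ EdgesCross s(a, b) f := by
    rintro f hf ⟨x, y, z, w, hxy, hyz, hzw, ⟨h1, rfl⟩ | ⟨h1, rfl⟩⟩
    · obtain ⟨rfl, rfl⟩ : a = x ∧ b = z := by
        rcases Sym2.eq_iff.1 h1 with h | ⟨rfl, rfl⟩
        · exact h
        · exact absurd (hxy.trans hyz) hab.not_gt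
      have hf' : H.Adj y w := hf
      have hr := not_isCrossingPartition_iff.1 hnc _ _ _ _ hxy hyz hzw hadj.reachable
        hf'.reachable
      obtain ⟨v, hv, hvy⟩ := hH.exists_lower_neighbor hr.symm hxy
      exact absurd (hmin _ _ hvy hv) hyz.not_ge
    · obtain ⟨rfl, rfl⟩ : a = y ∧ b = w := by
        rcases Sym2.eq_iff.1 h1 with h | ⟨rfl, rfl⟩
        · exact h
        · exact absurd (hyz.trans hzw) hab.not_gt
      exact absurd (hmin _ _ (hxy.trans hyz) hf) hzw.not_ge
  have hswap : ∀ {e f : Sym2 (Fin n)}, EdgesCross e f → EdgesCross f e := by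
    rintro e f ⟨x, y, z, w, h1, h2, h3, h | h⟩
    · exact ⟨x, y, z, w, h1, h2, h3, .inr h.symm⟩
    · exact ⟨x, y, z, w, h1, h2, h3, .inl h.symm⟩
  have herase : ∀ S ∈ noncrossingForests H, S.erase s(a, b) ∈ noncrossingForests H := by
    intro S hS
    rw [mem_noncrossingForests] at hS ⊢
    have hsub : ∀ {e}, e ∈ S.erase s(a, b) → e ∈ S := fun he => Finset.mem_of_mem_erase he
    exact ⟨fun e he => hS.1 (hsub he), fun i j k hi hj h1 h2 =>
      hS.2.1 i j k hi hj (hsub h1) (hsub h2), fun e he f hf => hS.2.2 e (hsub he) f (hsub hf)⟩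
  have hinsert : ∀ S ∈ noncrossingForests H, insert s(a, b) S ∈ noncrossingForests H := by
    intro S hS
    rw [mem_noncrossingForests] at hS ⊢
    have hsub : ((insert s(a, b) S : Finset _) : Set (Sym2 (Fin n))) ⊆ H.edgeSet := by
      rw [Finset.coe_insert]
      exact Set.insert_subset hadj hS.1
    refine ⟨hsub, fun i j k hi hj h1 h2 => ?_, fun e he f hf hef => ?_⟩
    · by_cases hk : k = b
      · subst hk
        rw [huniq i hi (hsub h1), huniq j hj (hsub h2)]
      · have key : ∀ {i}, i < k → s(i, k) ∈ insert s(a, b) S → s(i, k) ∈ S := by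
          intro i hi h
          rcases Finset.mem_insert.1 h with h | h
          · rcases Sym2.eq_iff.1 h with ⟨-, rfl⟩ | ⟨rfl, rfl⟩
            · exact absurd rfl hk
            · exact absurd hi hab.not_gt
          · exact h
        exact hS.2.1 i j k hi hj (key hi h1) (key hj h2)
    · rcases Finset.mem_insert.1 he with rfl | he'
      · exact hcross f (hsub hf) hef
      · rcases Finset.mem_insert.1 hf with rfl | hf'
        · exact hcross e (hsub he) (hswap hef)
        · exact hS.2.2 e he' f hf' hef
  refine Finset.sum_involution
    (fun S _ => if s(a, b) ∈ S then S.erase s(a, b) else insert s(a, b) S) ?_ ?_ ?_ ?_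
  · intro S _
    split_ifs with h
    · rw [← Finset.card_erase_add_one h, pow_succ]
      ring
    · rw [Finset.card_insert_of_notMem h, pow_succ]
      ring
  · intro S _ _
    split_ifs with h
    · exact fun e => Finset.notMem_erase s(a, b) S (e.symm ▸ h)
    · exact fun e => h (e ▸ Finset.mem_insert_self _ _)
  · intro S hS
    split_ifs with h
    · exact herase S hS
    · exact hinsert S hS
  · intro S _
    by_cases h : s(a, b) ∈ S
    · simp [h]
    · simp [h]

open Classical in
/-- The noncrossing bond with the same components as a noncrossing forest. -/
noncomputable def forestBond (G : SimpleGraph (Fin n)) (S : Finset (Sym2 (Fin n))) : NC G :=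
  if h : S ∈ noncrossingForests G then ⟨_, isNoncrossingBond_of_mem_noncrossingForests h⟩ else ⊥

theorem coe_forestBond {S : Finset (Sym2 (Fin n))} (hS : S ∈ noncrossingForests G) :
    (forestBond G S).1 = bondClosure G (forestGraph S) := by
  rw [forestBond, dif_pos hS]

theorem card_eq_sub_cc_forestBond {S : Finset (Sym2 (Fin n))} (hS : S ∈ noncrossingForests G) :
    S.card = n - cc (forestBond G S).1 := by
  rw [coe_forestBond hS, cc_congr fun _ _ => bondClosure_reachable (forestGraph_le hS),
    card_eq_sub_cc hS]

theorem forestBond_le_iff {S : Finset (Sym2 (Fin n))} (hS : S ∈ noncrossingForests G)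
    (H : NC G) : forestBond G S ≤ H ↔ S ∈ noncrossingForests H.1 := by
  have hle : forestBond G S ≤ H ↔ bondClosure G (forestGraph S) ≤ H.1 := by
    rw [← coe_forestBond hS]
    rfl
  rw [hle]
  constructor
  · intro h
    have h' := (le_bondClosure (forestGraph_le hS)).trans h
    rw [← edgeSet_subset_edgeSet, edgeSet_forestGraph hS] at h'
    exact mem_noncrossingForests.2 ⟨h', (mem_noncrossingForests.1 hS).2⟩
  · exact fun h => bondClosure_le H.2.1 (forestGraph_le h)

theorem noncrossingForests_mono {X Y : SimpleGraph (Fin n)} (h : X ≤ Y) :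
    noncrossingForests X ⊆ noncrossingForests Y := fun S hS => by
  rw [mem_noncrossingForests] at hS ⊢
  exact ⟨hS.1.trans (edgeSet_mono h), hS.2⟩

open Classical in
-- A forest inside `H` spans a bond below `H` of rank equal to its number of edges; strict
-- monotonicity of the rank forces that bond to be `H` once the ranks agree.
theorem filter_forestBond_eq (hG : IsPerfectlyLabeled G) (H : NC G) :
    (noncrossingForests G).filter (fun S => forestBond G S = H) =
      (noncrossingForests H.1).filter fun S => S.card = n - cc H.1 := by
  ext S
  simp only [Finset.mem_filter]
  constructor
  · rintro ⟨hS, rfl⟩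
    exact ⟨(forestBond_le_iff hS _).1 le_rfl, card_eq_sub_cc_forestBond hS⟩
  · rintro ⟨hS, hcard⟩
    have hSG := noncrossingForests_mono H.2.1.1 hS
    refine ⟨hSG, ?_⟩
    rcases ((forestBond_le_iff hSG H).2 hS).eq_or_lt with h | h
    · exact h
    · have h1 := strictMono_sub_cc hG h
      rw [card_eq_sub_cc_forestBond hSG] at hcard
      exact absurd hcard h1.ne

/-- The claimed value at `K` is the signed count of the forests spanning `K`. Summing over `K ≤ H`
collects every forest of `H` once, and `sum_noncrossingForests_eq_zero` gives the Möbius recursion.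
-/
theorem mobius_eq (hG : IsPerfectlyLabeled G) (H : NC G) :
    mobius H = (-1) ^ (n - cc H.1) *
      (((noncrossingForests H.1).filter fun S => S.card = n - cc H.1).card : ℤ) := by
  classical
  refine mobius_eq_of_sum (fun H : NC G => (-1 : ℤ) ^ (n - cc H.1) *
    (((noncrossingForests H.1).filter fun S => S.card = n - cc H.1).card : ℤ)) (fun H => ?_) H
  have hfib : ∀ K : NC G, (-1 : ℤ) ^ (n - cc K.1) *
      (((noncrossingForests K.1).filter fun S => S.card = n - cc K.1).card : ℤ) =
      ∑ S ∈ (noncrossingForests G).filter (fun S => forestBond G S = K), (-1 : ℤ) ^ S.card := by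
    intro K
    rw [filter_forestBond_eq hG, Finset.sum_congr rfl fun S hS => by
      rw [(Finset.mem_filter.1 hS).2], Finset.sum_const, nsmul_eq_mul, mul_comm]
  have hsum : ∑ K ∈ Finset.univ.filter (· ≤ H), (-1 : ℤ) ^ (n - cc K.1) *
      (((noncrossingForests K.1).filter fun S => S.card = n - cc K.1).card : ℤ) =
      ∑ S ∈ noncrossingForests H.1, (-1 : ℤ) ^ S.card := by
    rw [← Finset.sum_fiberwise_of_maps_to (s := noncrossingForests H.1)
      (t := Finset.univ.filter (· ≤ H)) (g := forestBond G)]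
    · refine Finset.sum_congr rfl fun K hK => ?_
      rw [hfib]
      refine Finset.sum_congr ?_ fun _ _ => rfl
      ext S
      simp only [Finset.mem_filter]
      refine and_congr_left fun hSK => ⟨fun hS => ?_, fun hS =>
        noncrossingForests_mono H.2.1.1 hS⟩
      subst hSK
      exact (forestBond_le_iff hS H).1 (Finset.mem_filter.1 hK).2
    · intro S hS
      simp only [Finset.mem_filter, Finset.mem_univ, true_and]
      exact (forestBond_le_iff (noncrossingForests_mono H.2.1.1 hS) H).2 hS
  rw [hsum]
  split_ifs with h
  · subst h
    have : noncrossingForests (⊥ : NC G).1 = {∅} := by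
      ext S
      rw [mem_noncrossingForests, show (⊥ : NC G).1 = ⊥ from rfl, edgeSet_bot,
        Set.subset_empty_iff, Finset.coe_eq_empty, Finset.mem_singleton]
      refine ⟨fun h => h.1, ?_⟩
      rintro rfl
      simp [HasUniqueDescents]
    simp [this]
  · exact sum_noncrossingForests_eq_zero (hG.of_isBond H.2.1) H.2.2 fun e => h (Subtype.ext e)

theorem card_le_of_mem_noncrossingForests {S : Finset (Sym2 (Fin n))}
    (hS : S ∈ noncrossingForests G) : S.card ≤ n - cc G := by
  rw [card_eq_sub_cc hS]
  have := cc_anti (forestGraph_le hS)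
  omega

/-- Both sides are the sum of `(-1)^|S| X^(r - |S|)` over all noncrossing forests `S` of `G`,
grouped by spanned bond on the left and by cardinality on the right. -/
theorem charPoly_eq (hG : IsPerfectlyLabeled G) {r : ℕ} (hr : posetRank (NC G) = r)
    (hle : ∀ S ∈ noncrossingForests G, S.card ≤ r) :
    charPoly (NC G) = ∑ k ∈ Finset.range (r + 1),
      Polynomial.C ((-1) ^ k *
        (((noncrossingForests G).filter fun S => S.card = k).card : ℤ)) *
        Polynomial.X ^ (r - k) := by
  classical
  have h1 : charPoly (NC G) = ∑ S ∈ noncrossingForests G,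
      Polynomial.C ((-1 : ℤ) ^ S.card) * Polynomial.X ^ (r - S.card) := by
    rw [charPoly, hr, ← Finset.sum_fiberwise_of_maps_to (t := Finset.univ) (g := forestBond G)
      fun _ _ => Finset.mem_univ _]
    refine Finset.sum_congr rfl fun H _ => ?_
    rw [filter_forestBond_eq hG, Finset.sum_congr rfl fun S hS => by
      rw [(Finset.mem_filter.1 hS).2], Finset.sum_const, mobius_eq hG, rank_eq hG, nsmul_eq_mul,
      Polynomial.C_mul, map_natCast Polynomial.C]
    ring
  rw [h1, ← Finset.sum_fiberwise_of_maps_to (t := Finset.range (r + 1)) (g := Finset.card)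
    fun S hS => Finset.mem_range_succ_iff.2 (hle S hS)]
  refine Finset.sum_congr rfl fun k _ => ?_
  rw [Finset.sum_congr rfl fun S hS => by rw [(Finset.mem_filter.1 hS).2], Finset.sum_const,
    nsmul_eq_mul, Polynomial.C_mul, map_natCast Polynomial.C]
  ring

end Moebius

end NCBond

theorem theorem5p6 (n : ℕ) (G : SimpleGraph (Fin n)) (hG : IsPerfectlyLabeled G)
    (hTop : ∃ T : NC G, IsTop T) :
    -- gradedness and the rank function
    (IsGraded (NC G) ∧ IsRankFunction (rank : NC G → ℕ) ∧
      ∀ H : NC G, cc H.1 ≤ n ∧ rank H = n - cc H.1) ∧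
    -- EL-labeling and shellability
    (IsELLabeling (minLabeling G) ∧ IsShellable (NC G)) ∧
    -- the Möbius function
    (∀ H : NC G,
      mobius H = (-1) ^ (n - cc H.1) * (ncnbc (n - cc H.1) H.1 : ℤ) ∧
      mobius H = (-1) ^ (n - cc H.1) * (ncisf (n - cc H.1) H.1 : ℤ)) ∧
    -- the characteristic polynomial; the sums over all `k ≥ 0` stop at the rank of the poset
    -- because the coefficients vanish from there on
    (charPoly (NC G) =
        ∑ k ∈ Finset.range (posetRank (NC G) + 1),
          Polynomial.C ((-1) ^ k * (ncnbc k G : ℤ)) * Polynomial.X ^ (posetRank (NC G) - k) ∧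
      charPoly (NC G) =
        ∑ k ∈ Finset.range (posetRank (NC G) + 1),
          Polynomial.C ((-1) ^ k * (ncisf k G : ℤ)) * Polynomial.X ^ (posetRank (NC G) - k) ∧
      ∀ k, posetRank (NC G) < k → ncnbc k G = 0 ∧ ncisf k G = 0) := by
  obtain ⟨T, hT⟩ := hTop
  have hlab := isMinLabeling_minLabeling hG
  have hmono := strictMono_sub_cc hG
  have hcov := sub_cc_of_covBy hG
  have hbot : IsBot (⊥ : NC G) := fun _ => bot_le
  have hle : ∀ S ∈ noncrossingForests G, S.card ≤ posetRank (NC G) := fun S hS => by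
    rw [posetRank_eq hG hT]
    exact card_le_of_mem_noncrossingForests hS
  refine ⟨⟨isGraded_of_covBy hcov hbot hT, ⟨fun H hH => ?_, fun H H' h => ?_⟩,
    fun H => ⟨cc_le H.1, rank_eq hG H⟩⟩,
    ⟨hlab.isELLabeling, hlab.isShellable hmono hcov hbot hT⟩, fun H => ⟨?_, ?_⟩, ?_, ?_,
    fun k hk => ?_⟩
  · rw [hH.eq_bot, rank_eq hG, show (⊥ : NC G).1 = ⊥ from rfl, cc_bot, Nat.sub_self]
  · rw [rank_eq hG, rank_eq hG, hcov H H' h]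
  · rw [ncnbc_eq_card (hG.of_isBond H.2.1), mobius_eq hG]
  · rw [ncisf_eq_card, mobius_eq hG]
  · simp only [ncnbc_eq_card hG]
    exact charPoly_eq hG rfl hle
  · simp only [ncisf_eq_card]
    exact charPoly_eq hG rfl hle
  · rw [ncnbc_eq_card hG, ncisf_eq_card, and_self, Finset.card_eq_zero,
      Finset.filter_eq_empty_iff]
    exact fun S hS h => (hk.trans_le (h ▸ hle S hS)).false
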